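/- Let $\Lambda$ be an artin algebra with centre $R$ (that is, $\Lambda$ is a ring which is a finitely generated module over some commutative artinian ring $k$ acting centrally). Let $(\mathcal A,\mathbb E,\mathfrak s)$ be an extriangulated category in the sense of Nakaoka and Palu which is Krull–Schmidt (every object is a finite direct sum of objects with local endomorphism rings) and $R$-linear ($\mathcal A$ is an $R$-linear category, the groups $\mathbb E(C,A)$ are $R$-modules, and $\mathbb E$ is an $R$-bilinear functor). A *length function* $\Theta$ assigns to every isomorphism class of objects of $\mathcal A$ a natural number such that $\Theta(X)=0$ if and only if $X\cong 0$, and such that every $\mathbb E$-triangle $X\to L\to M\overset{\delta}{\dashrightarrow}$ satisfies $\Theta(L)\le\Theta(X)+\Theta(M)$, with equality if $\delta=0$. An $\mathbb E$-triangle $X\overset{x}\to L\overset{y}\to M\dashrightarrow$ with $\Theta(L)=\Theta(X)+\Theta(M)$ is called *stable*; then $x$ is a *$\Theta$-inflation* and $y$ a *$\Theta$-deflation*. The pair $(\mathcal A,\Theta)$ is a *length category* if every morphism of $\mathcal A$ is a $\Theta$-deflation followed by a $\Theta$-inflation. Let $\Theta_1$ be the set of isomorphism classes of nonzero objects of minimal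 length; for $n\ge2$ let $\Theta_n$ be the union of $\Theta_{n-1}$ and the set of all $M$ with $\Theta(M)=n$ such that $\operatorname{Hom}(X,M)=0=\operatorname{Hom}(M,X)$ for all $X\in\Theta_{n-1}$; and let $\Theta_\infty=\bigcup_{n\ge1}\Theta_n$. Let $\operatorname{ind}(\mathcal A)$ be the set of isomorphism classes of indecomposable objects, with $X\le Y$ if there is a $\Theta$-inflation $X\to Y$. Order the finite subsets of $\mathbb N$ by $I\le J$ if and only if $\min(J\setminus I)\le\min(I\setminus J)$, where $\min\emptyset=\infty$. The *Gabriel–Roiter measure* of $M\in\operatorname{ind}(\mathcal A)$ is $$\Theta^*(M)=\max\{\{\Theta(X)\mid X\in\mathbf X\}\mid \mathbf X\subseteq\operatorname{ind}(\mathcal A)\text{ a finite chain with maximal element }M\}.$$ The *Gabriel–Roiter chain* $I_1<I_2<\cdots$ is the (finite or infinite) sequence in which $I_1$ is the least Gabriel–Roiter measure and $I_{t+1}$ is the least Gabriel–Roiter measure which is strictly bigger than $I_t$, as long as there is one. It is said to *have an upper bound* if it has only finitely many terms $I_1<\cdots<I_m$. **Theorem.** Let $(\mathcal A,\Theta)$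 be a length category of finite type; that is, the $R$-modules $\operatorname{Hom}_{\mathcal A}(A,B)$ and $\mathbb E(A,B)$ have finite length for all objects $A,B$, one has $\Theta_1=\Theta_\infty$, and $\Theta_1$ is finite. Then the following statements are equivalent. 1. $\operatorname{ind}(\mathcal A)$ is finite. 2. The set $\{\Theta(M)\mid M\in\operatorname{ind}(\mathcal A)\}$ has an upper bound. 3. The Gabriel–Roiter chain $I_1<I_2<\cdots$ has an upper bound. In particular (the equivalence of 1 and 2), the first Brauer–Thrall conjecture holds for $(\mathcal A,\Theta)$. -/

import Mathlib

open CategoryTheory CategoryTheory.Limits Opposite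

universe w v u

/-! ## Extriangulated categories -/

section Extriangulated

variable {C : Type u} [Category.{v} C]

/-- A sequence of morphisms `A ⟶ B ⟶ C'` with fixed end terms. -/
structure ThreeTermSeq (A C' : C) where
  mid : C
  inf : A ⟶ mid
  defl : mid ⟶ C'

/-- Two sequences with the same end terms are equivalent if there is an isomorphism of the middle
terms which is compatible with the identities of the end terms. -/
def threeTermSetoid (A C' : C) : Setoid (ThreeTermSeq A C') where
  r S T := ∃ b : S.mid ≅ T.mid, S.inf ≫ b.hom = T.inf ∧ b.hom ≫ T.defl = S.defl
  iseqv :=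
    { refl := fun S => ⟨Iso.refl _, by simp, by simp⟩
      symm := by
        rintro S T ⟨b, h1, h2⟩
        exact ⟨b.symm, by simp [← h1], by simp [← h2]⟩
      trans := by
        rintro S T U ⟨b, h1, h2⟩ ⟨c, h3, h4⟩
        exact ⟨b ≪≫ c, by simp [reassoc_of% h1, h3], by simp [h4, h2]⟩ }

/-- The equivalence class `[A ⟶ B ⟶ C']`. -/
def seqClass {A B C' : C} (x : A ⟶ B) (y : B ⟶ C') : Quotient (threeTermSetoid A C') :=
  Quotient.mk _ ⟨B, x, y⟩

variable (C) in
/-- A biadditive functor `𝔼 : Cᵒᵖ × C ⥤ Ab` together with a correspondence `s` which sends every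
extension `δ ∈ 𝔼(C', A)` to an equivalence class of sequences `A ⟶ B ⟶ C'`. -/
structure ExtriangulatedData [Preadditive C] where
  E : Cᵒᵖ ⥤ C ⥤ AddCommGrpCat.{w}
  additive_right : ∀ X : Cᵒᵖ, (E.obj X).Additive
  additive_left : ∀ A : C, (E.flip.obj A).Additive
  s : ∀ {C' A : C}, ((E.obj (op C')).obj A) → Quotient (threeTermSetoid A C')

namespace ExtriangulatedData

variable [Preadditive C] (𝓔 : ExtriangulatedData.{w} C)

/-- The group `𝔼(C', A)` of extensions. -/
abbrev Ext (C' A : C) : Type w := (𝓔.E.obj (op C')).obj A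

/-- `a_* δ = 𝔼(C', a)(δ)`. -/
def push {C' A A' : C} (a : A ⟶ A') (δ : 𝓔.Ext C' A) : 𝓔.Ext C' A' :=
  (𝓔.E.obj (op C')).map a δ

/-- `c^* δ = 𝔼(c, A)(δ)`. -/
def pull {C' C'' A : C} (c : C'' ⟶ C') (δ : 𝓔.Ext C' A) : 𝓔.Ext C'' A :=
  (𝓔.E.map c.op).app A δ

/-- `A ⟶ B ⟶ C'` realizes `δ`; in other words, `A ⟶ B ⟶ C' ⇢ δ` is an `𝔼`-triangle. -/
def Realizes {A B C' : C} (x : A ⟶ B) (y : B ⟶ C') (δ : 𝓔.Ext C' A) : Prop :=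
  𝓔.s δ = seqClass x y

/-- The extension `δ ⊕ δ' ∈ 𝔼(C₁ ⊞ C₂, A₁ ⊞ A₂)`, whose components are `(δ, 0, 0, δ')`. -/
noncomputable def extSum [HasBinaryBiproducts C] {C₁ C₂ A₁ A₂ : C}
    (δ : 𝓔.Ext C₁ A₁) (δ' : 𝓔.Ext C₂ A₂) : 𝓔.Ext (C₁ ⊞ C₂) (A₁ ⊞ A₂) :=
  𝓔.push biprod.inl (𝓔.pull biprod.fst δ) + 𝓔.push biprod.inr (𝓔.pull biprod.snd δ')

end ExtriangulatedData

/-- The axioms of an extriangulated category `(C, 𝔼, s)` in the sense of Nakaoka and Palu. The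
axiom (ET1) is part of `ExtriangulatedData`. -/
structure IsExtriangulated [Preadditive C] [HasBinaryBiproducts C]
    (𝓔 : ExtriangulatedData.{w} C) : Prop where
  /-- (ET2), `s` is a realization: every morphism `(a, c)` of extensions is realized by some
  `(a, b, c)`. -/
  realization : ∀ {A B D A' B' D' : C} {x : A ⟶ B} {y : B ⟶ D} {x' : A' ⟶ B'} {y' : B' ⟶ D'}
    {δ : 𝓔.Ext D A} {δ' : 𝓔.Ext D' A'}, 𝓔.Realizes x y δ → 𝓔.Realizes x' y' δ' →
    ∀ (a : A ⟶ A') (c : D ⟶ D'), 𝓔.push a δ = 𝓔.pull c δ' →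
      ∃ b : B ⟶ B', x ≫ b = a ≫ x' ∧ y ≫ c = b ≫ y'
  /-- (ET2), `s(0) = 0`. -/
  realizes_zero : ∀ A D : C,
    𝓔.Realizes (biprod.inl : A ⟶ A ⊞ D) (biprod.snd : A ⊞ D ⟶ D) (0 : 𝓔.Ext D A)
  /-- (ET2), `s(δ ⊕ δ') = s(δ) ⊕ s(δ')`. -/
  realizes_sum : ∀ {A B D A' B' D' : C} {x : A ⟶ B} {y : B ⟶ D} {x' : A' ⟶ B'} {y' : B' ⟶ D'}
    {δ : 𝓔.Ext D A} {δ' : 𝓔.Ext D' A'}, 𝓔.Realizes x y δ → 𝓔.Realizes x' y' δ' →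
    𝓔.Realizes (biprod.map x x') (biprod.map y y') (𝓔.extSum δ δ')
  /-- (ET3). -/
  et3 : ∀ {A B D A' B' D' : C} {x : A ⟶ B} {y : B ⟶ D} {x' : A' ⟶ B'} {y' : B' ⟶ D'}
    {δ : 𝓔.Ext D A} {δ' : 𝓔.Ext D' A'}, 𝓔.Realizes x y δ → 𝓔.Realizes x' y' δ' →
    ∀ (a : A ⟶ A') (b : B ⟶ B'), x ≫ b = a ≫ x' →
      ∃ c : D ⟶ D', y ≫ c = b ≫ y' ∧ 𝓔.push a δ = 𝓔.pull c δ'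
  /-- The dual of (ET3). -/
  et3_op : ∀ {A B D A' B' D' : C} {x : A ⟶ B} {y : B ⟶ D} {x' : A' ⟶ B'} {y' : B' ⟶ D'}
    {δ : 𝓔.Ext D A} {δ' : 𝓔.Ext D' A'}, 𝓔.Realizes x y δ → 𝓔.Realizes x' y' δ' →
    ∀ (b : B ⟶ B') (c : D ⟶ D'), y ≫ c = b ≫ y' →
      ∃ a : A ⟶ A', x ≫ b = a ≫ x' ∧ 𝓔.push a δ = 𝓔.pull c δ'
  /-- (ET4). -/
  et4 : ∀ {A B G D F : C} {f : A ⟶ B} {f' : B ⟶ D} {g : B ⟶ G} {g' : G ⟶ F}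
    {δ : 𝓔.Ext D A} {δ' : 𝓔.Ext F B}, 𝓔.Realizes f f' δ → 𝓔.Realizes g g' δ' →
    ∃ (H : C) (d : D ⟶ H) (e : H ⟶ F) (h : A ⟶ G) (h' : G ⟶ H) (δ'' : 𝓔.Ext H A),
      f ≫ g = h ∧ f' ≫ d = g ≫ h' ∧ h' ≫ e = g' ∧
      𝓔.Realizes h h' δ'' ∧ 𝓔.Realizes d e (𝓔.push f' δ') ∧
      𝓔.pull d δ'' = δ ∧ 𝓔.push f δ'' = 𝓔.pull e δ'
  /-- The dual of (ET4). -/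
  et4_op : ∀ {A B G D F : C} {f' : D ⟶ A} {f : A ⟶ B} {g' : F ⟶ B} {g : B ⟶ G}
    {δ : 𝓔.Ext B D} {δ' : 𝓔.Ext G F}, 𝓔.Realizes f' f δ → 𝓔.Realizes g' g δ' →
    ∃ (H : C) (d : D ⟶ H) (e : H ⟶ F) (h' : H ⟶ A) (h : A ⟶ G) (δ'' : 𝓔.Ext G H),
      f ≫ g = h ∧ d ≫ h' = f' ∧ h' ≫ f = e ≫ g' ∧
      𝓔.Realizes h' h δ'' ∧ 𝓔.Realizes d e (𝓔.pull g' δ) ∧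
      𝓔.push e δ'' = δ' ∧ 𝓔.push d δ = 𝓔.pull g δ''

/-- An `R`-linear structure on `(C, 𝔼, s)`, for an `R`-linear category `C`: the groups `𝔼(D, A)`
are `R`-modules and `𝔼` is an `R`-bilinear functor. -/
class ExtriangulatedData.RLinear (R : Type*) [CommRing R] [Preadditive C] [Linear R C]
    (𝓔 : ExtriangulatedData.{w} C) where
  module : ∀ D A : C, Module R (𝓔.Ext D A)
  push_smul : ∀ {D A A' : C} (r : R) (a : A ⟶ A') (δ : 𝓔.Ext D A),
    𝓔.push a (r • δ) = r • 𝓔.push a δ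
  smul_push : ∀ {D A A' : C} (r : R) (a : A ⟶ A') (δ : 𝓔.Ext D A),
    𝓔.push (r • a) δ = r • 𝓔.push a δ
  pull_smul : ∀ {D D' A : C} (r : R) (c : D' ⟶ D) (δ : 𝓔.Ext D A),
    𝓔.pull c (r • δ) = r • 𝓔.pull c δ
  smul_pull : ∀ {D D' A : C} (r : R) (c : D' ⟶ D) (δ : 𝓔.Ext D A),
    𝓔.pull (r • c) δ = r • 𝓔.pull c δ

attribute [instance, reducible] ExtriangulatedData.RLinear.module

/-- All groups `Hom(A, B)` and `𝔼(A, B)` have finite length as `R`-modules. -/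
def ExtriangulatedData.RFinite (R : Type*) [CommRing R] [Preadditive C] [Linear R C]
    (𝓔 : ExtriangulatedData.{w} C) [𝓔.RLinear R] : Prop :=
  ∀ A B : C, Module.length R (A ⟶ B) < ⊤ ∧ Module.length R (𝓔.Ext A B) < ⊤

end Extriangulated

/-- Every object is a finite direct sum of objects with local endomorphism rings. -/
def IsKrullSchmidt (C : Type u) [Category.{v} C] [Preadditive C] [HasFiniteBiproducts C] : Prop :=
  ∀ X : C, ∃ (n : ℕ) (Y : Fin n → C), (∀ i, IsLocalRing (End (Y i))) ∧ Nonempty (X ≅ ⨁ Y)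

/-! ## Length functions and length categories -/

section Length

variable {C : Type u} [Category.{v} C] [Preadditive C]

/-- A length function on `(C, 𝔼, s)`, as a function on objects which is constant on isomorphism
classes. -/
structure LengthFunction (𝓔 : ExtriangulatedData.{w} C) where
  len : C → ℕ
  len_iso : ∀ {X Y : C}, (X ≅ Y) → len X = len Y
  len_eq_zero : ∀ X : C, len X = 0 ↔ IsZero X
  len_le : ∀ {X L M : C} {x : X ⟶ L} {y : L ⟶ M} {δ : 𝓔.Ext M X}, 𝓔.Realizes x y δ →
    len L ≤ len X + len M
  len_split : ∀ {X L M : C} {x : X ⟶ L} {y : L ⟶ M}, 𝓔.Realizes x y (0 : 𝓔.Ext M X) →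
    len L = len X + len M

namespace LengthFunction

variable {𝓔 : ExtriangulatedData.{w} C} (Θ : LengthFunction 𝓔)

/-- The `𝔼`-triangle `X ⟶ L ⟶ M ⇢ δ` is `Θ`-stable. -/
def IsStable {X L M : C} (x : X ⟶ L) (y : L ⟶ M) (δ : 𝓔.Ext M X) : Prop :=
  𝓔.Realizes x y δ ∧ Θ.len L = Θ.len X + Θ.len M

/-- `Θ`-inflations. -/
def IsInflation {X L : C} (x : X ⟶ L) : Prop :=
  ∃ (M : C) (y : L ⟶ M) (δ : 𝓔.Ext M X), Θ.IsStable x y δ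

/-- `Θ`-deflations. -/
def IsDeflation {L M : C} (y : L ⟶ M) : Prop :=
  ∃ (X : C) (x : X ⟶ L) (δ : 𝓔.Ext M X), Θ.IsStable x y δ

/-- `Θ`-admissible morphisms: a `Θ`-deflation followed by a `Θ`-inflation. -/
def IsAdmissible {M N : C} (f : M ⟶ N) : Prop :=
  ∃ (X : C) (i : M ⟶ X) (j : X ⟶ N), Θ.IsDeflation i ∧ Θ.IsInflation j ∧ i ≫ j = f

/-- `(C, Θ)` is a length category: every morphism is `Θ`-admissible. -/
def IsLengthCategory : Prop :=
  ∀ {M N : C} (f : M ⟶ N), Θ.IsAdmissible f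

/-- The objects of `Θ₁`: the nonzero objects of minimal length. -/
def thetaOne : Set C :=
  {M | 0 < Θ.len M ∧ ∀ N : C, ¬ IsZero N → Θ.len M ≤ Θ.len N}

/-- `Θ.theta n` consists of the objects of `Θ_{n+1}`: one has
`Θ_n = Θ_{n-1} ∪ {M ∈ Θ_{n-1}^⊥ ∩ ^⊥Θ_{n-1} | Θ(M) = n}` for `n ≥ 2`. -/
def theta : ℕ → Set C
  | 0 => Θ.thetaOne
  | n + 1 => theta n ∪
      {M | (∀ X ∈ theta n, (∀ f : X ⟶ M, f = 0) ∧ (∀ f : M ⟶ X, f = 0)) ∧ Θ.len M = n + 2}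

/-- The objects of `Θ_∞ = ⋃ₙ Θ_n`. -/
def thetaInfty : Set C := ⋃ n, Θ.theta n

end LengthFunction

end Length

/-! ## The Gabriel-Roiter measure -/

section Lex

/-- The lexicographical order on finite subsets of `ℕ`: `I ≤ J` iff
`min (J \ I) ≤ min (I \ J)`, where `min ∅ = ⊤`. -/
def LexLE (I J : Finset ℕ) : Prop := (J \ I).min ≤ (I \ J).min

/-- `I` is the least element of `S` in the lexicographical order. -/
def IsLexLeast (S : Set (Finset ℕ)) (I : Finset ℕ) : Prop := I ∈ S ∧ ∀ J ∈ S, LexLE I J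

/-- `I` is the greatest element of `S` in the lexicographical order. -/
def IsLexGreatest (S : Set (Finset ℕ)) (I : Finset ℕ) : Prop := I ∈ S ∧ ∀ J ∈ S, LexLE J I

theorem lexLE_iff_colex (I J : Finset ℕ) : LexLE I J ↔
    toColex (I.map OrderDual.toDual.toEmbedding) ≤ toColex (J.map OrderDual.toDual.toEmbedding) := by
  rw [Finset.Colex.toColex_le_toColex]
  constructor
  · intro h a ha ha'
    obtain ⟨n, hn, rfl⟩ := Finset.mem_map.1 ha
    have hnJ : n ∉ J := fun hJ => ha' (Finset.mem_map.2 ⟨n, hJ, rfl⟩)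
    have hle : (J \ I).min ≤ (n : WithTop ℕ) :=
      h.trans (Finset.min_le (Finset.mem_sdiff.2 ⟨hn, hnJ⟩))
    obtain ⟨m, hm⟩ := WithTop.ne_top_iff_exists.1 (ne_top_of_le_ne_top (WithTop.coe_ne_top) hle)
    have hmem := Finset.mem_sdiff.1 (Finset.mem_of_min hm.symm)
    rw [← hm] at hle
    refine ⟨OrderDual.toDual m, Finset.mem_map.2 ⟨m, hmem.1, rfl⟩, ?_, ?_⟩
    · intro hI
      obtain ⟨k, hk, hkm⟩ := Finset.mem_map.1 hI
      exact hmem.2 (OrderDual.toDual.injective hkm ▸ hk)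
    · exact OrderDual.toDual_le_toDual.2 (WithTop.coe_le_coe.1 hle)
  · intro h
    refine Finset.le_min fun n hn => ?_
    obtain ⟨hn, hnJ⟩ := Finset.mem_sdiff.1 hn
    have hn' : OrderDual.toDual n ∉ J.map OrderDual.toDual.toEmbedding := by
      intro hJ
      obtain ⟨k, hk, hkm⟩ := Finset.mem_map.1 hJ
      exact hnJ (OrderDual.toDual.injective hkm ▸ hk)
    obtain ⟨b, hb, hbI, hle⟩ := h (Finset.mem_map.2 ⟨n, hn, rfl⟩) hn'
    obtain ⟨m, hm, rfl⟩ := Finset.mem_map.1 hb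
    have hmI : m ∉ I := fun hI => hbI (Finset.mem_map.2 ⟨m, hI, rfl⟩)
    exact (Finset.min_le (Finset.mem_sdiff.2 ⟨hm, hmI⟩)).trans
      (WithTop.coe_le_coe.2 (OrderDual.toDual_le_toDual.1 hle))

theorem exists_isLexGreatest (S : Set (Finset ℕ)) (hf : S.Finite) (hne : S.Nonempty) :
    ∃ I, IsLexGreatest S I := by
  obtain ⟨I, hI, hmax⟩ := Set.exists_max_image S
    (fun I => toColex (I.map OrderDual.toDual.toEmbedding)) hf hne
  exact ⟨I, hI, fun J hJ => (lexLE_iff_colex J I).2 (hmax J hJ)⟩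

end Lex

/-- The set `Iso(C)` of isomorphism classes of objects. -/
abbrev IsoClass (C : Type u) [Category.{v} C] : Type u := Quotient (isIsomorphicSetoid C)

/-- The isomorphism class of an object. -/
def isoClass {C : Type u} [Category.{v} C] (X : C) : IsoClass C := Quotient.mk _ X

/-- The set `ind(C)` of isomorphism classes of indecomposable objects. -/
abbrev IndClass (C : Type u) [Category.{v} C] [Preadditive C] [HasBinaryBiproducts C] : Type u :=
  {c : IsoClass C // ∃ X : C, Indecomposable X ∧ isoClass X = c}

section Measure

variable {C : Type u} [Category.{v} C] [Preadditive C]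

namespace LengthFunction

variable {𝓔 : ExtriangulatedData.{w} C} (Θ : LengthFunction 𝓔)

/-- The length of an isomorphism class. -/
def isoLen : IsoClass C → ℕ := Quotient.lift Θ.len fun _ _ ⟨e⟩ => Θ.len_iso e

/-- The relation `X ≤ Y` on isomorphism classes: there is a `Θ`-inflation `X ⟶ Y`. -/
def Sub (c d : IsoClass C) : Prop :=
  ∃ (X Y : C) (f : X ⟶ Y), isoClass X = c ∧ isoClass Y = d ∧ Θ.IsInflation f

theorem isoLen_le_of_sub {c d : IsoClass C} (h : Θ.Sub c d) : Θ.isoLen c ≤ Θ.isoLen d := by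
  obtain ⟨X, Y, f, rfl, rfl, M, y, δ, -, hl⟩ := h
  change Θ.len X ≤ Θ.len Y
  omega

variable [HasBinaryBiproducts C]

/-- The set `Ch(ind(C), c)` of finite chains of indecomposables with maximal element `c`. -/
def chainsTo (c : IndClass C) : Set (Finset (IndClass C)) :=
  {s | IsChain (fun a b : IndClass C => Θ.Sub a.1 b.1) (s : Set (IndClass C)) ∧
    c ∈ s ∧ ∀ d ∈ s, d ≠ c → Θ.Sub d.1 c.1}

/-- The sets `Θ(𝐗) ⊆ ℕ`, for the chains `𝐗` with maximal element `c`. -/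
def chainLengths (c : IndClass C) : Set (Finset ℕ) :=
  (fun s : Finset (IndClass C) => s.image fun d => Θ.isoLen d.1) '' Θ.chainsTo c

theorem exists_grMeasure (c : IndClass C) : ∃ I, IsLexGreatest (Θ.chainLengths c) I := by
  refine exists_isLexGreatest _ ?_ ?_
  · refine Set.Finite.subset (Finset.finite_toSet (Finset.range (Θ.isoLen c.1 + 1)).powerset) ?_
    rintro I ⟨s, ⟨-, -, hs⟩, rfl⟩
    simp only [Finset.coe_powerset, Set.mem_preimage, Set.mem_powerset_iff, Finset.coe_subset]
    intro n hn
    obtain ⟨d, hd, rfl⟩ := Finset.mem_image.1 hn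
    rw [Finset.mem_range, Nat.lt_succ_iff]
    by_cases h : d = c
    · rw [h]
    · exact Θ.isoLen_le_of_sub (hs d hd h)
  · exact ⟨_, {c}, ⟨by simp, by simp, by simp +contextual⟩, rfl⟩

/-- The Gabriel-Roiter measure `Θ^*(c) = max {Θ(𝐗) | 𝐗 ∈ Ch(ind(C), c)}`, the maximum being taken
in the lexicographical order. -/
noncomputable def grMeasure (c : IndClass C) : Finset ℕ := (Θ.exists_grMeasure c).choose

theorem grMeasure_spec (c : IndClass C) :
    IsLexGreatest (Θ.chainLengths c) (Θ.grMeasure c) := (Θ.exists_grMeasure c).choose_spec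

/-- `Θ.IsGRTerm n I` says that `I` is the term `I_{n+1}` of the Gabriel-Roiter chain
`I₁ < I₂ < ⋯`: the term `I₁` is the least measure, and `I_{t+1}` is the least measure which is
strictly bigger than `I_t`. -/
def IsGRTerm : ℕ → Finset ℕ → Prop
  | 0, I => IsLexLeast (Set.range Θ.grMeasure) I
  | n + 1, I => ∃ J, IsGRTerm n J ∧
      IsLexLeast {K | K ∈ Set.range Θ.grMeasure ∧ LexLE J K ∧ J ≠ K} I

/-- The Gabriel-Roiter chain has an upper bound: it has only finitely many terms
`I₁ < ⋯ < I_m`. -/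
def GRChainBounded : Prop := BddAbove {n : ℕ | ∃ I, Θ.IsGRTerm n I}

end LengthFunction

end Measure

/-! 1 → 2 → 3 is counting: a measure consists of numbers bounded by the length of its object, so
bounded lengths leave only finitely many measures. The substance is 3 → 1: with infinitely many
indecomposables, the Gabriel–Roiter chain never stops. Two facts always produce its next term: the
complement of a finite set `S` of indecomposables contains one of least measure
(`exists_least_grKey`), and if only finitely many indecomposables have measure below `κ`, then only
finitely many have measure `κ` (`finite_grKey_eq`).

For the first fact, replace an indecomposable outside `S` by its shortest indecomposable subobject
`M` outside `S`; this does not raise the measure. Since `Θ₁ = Θ_∞`, there is a deflation from `M` to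
some `T` in `Θ₁`. The summands of its kernel are shorter subobjects, hence in `S`, and none of them
splits off `M`. So each occurs at most as often as the length of an extension group of `T` allows
(`exists_retract_of_length_lt`). As `T` varies in a finite set, the length of `M` is bounded
(`exists_isoLen_bound`), and only finitely many measures compete for the minimum.

The second fact rests on Gabriel's main property (`exists_retraction_or_grKey_lt`): an
indecomposable subobject splits off unless the big object has a summand of larger measure. Hence
objects with all summands of measure below `κ` are closed under subobjects, and every `M` has a left
approximation `M ⟶ L` by them. Infinitely many `M` of measure `κ` have the same length, so
infinitely many of them share one `L`. The kernel of the map to `L` from a large sum of these `M j`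
is too long to have all its summands below `κ`, so one of its summands splits off the sum. The
resulting relation gives `q k ≫ (𝟙 + radical) = 0`, contradicting `q k ≠ 0`
(`not_exists_common_approximation`). -/

/-! ### Exactness properties of `𝔼`-triangles. -/

section Exactness

variable {C : Type u} [Category.{v} C] [Preadditive C]

namespace ExtriangulatedData

variable (𝓔 : ExtriangulatedData.{w} C)

@[simp] theorem push_id {D A : C} (δ : 𝓔.Ext D A) : 𝓔.push (𝟙 A) δ = δ := by
  simp [push]

@[simp] theorem pull_id {D A : C} (δ : 𝓔.Ext D A) : 𝓔.pull (𝟙 D) δ = δ := by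
  simp [pull]

theorem push_comp {D A A' A'' : C} (a : A ⟶ A') (b : A' ⟶ A'') (δ : 𝓔.Ext D A) :
    𝓔.push (a ≫ b) δ = 𝓔.push b (𝓔.push a δ) := by
  simp [push]

theorem pull_comp {D D' D'' A : C} (c : D' ⟶ D) (d : D'' ⟶ D') (δ : 𝓔.Ext D A) :
    𝓔.pull (d ≫ c) δ = 𝓔.pull d (𝓔.pull c δ) := by
  simp [pull]

@[simp] theorem push_zero_right {D A A' : C} (a : A ⟶ A') :
    𝓔.push a (0 : 𝓔.Ext D A) = 0 :=
  map_zero ((𝓔.E.obj (op D)).map a).hom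

@[simp] theorem pull_zero_right {D D' A : C} (c : D' ⟶ D) :
    𝓔.pull c (0 : 𝓔.Ext D A) = 0 :=
  map_zero ((𝓔.E.map c.op).app A).hom

theorem push_add {D A A' : C} (a b : A ⟶ A') (δ : 𝓔.Ext D A) :
    𝓔.push (a + b) δ = 𝓔.push a δ + 𝓔.push b δ := by
  have := 𝓔.additive_right (op D)
  simp [push, Functor.map_add]

theorem pull_add {D D' A : C} (c d : D' ⟶ D) (δ : 𝓔.Ext D A) :
    𝓔.pull (c + d) δ = 𝓔.pull c δ + 𝓔.pull d δ := by
  have := 𝓔.additive_left A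
  have h : (𝓔.E.flip.obj A).map (c.op + d.op) =
    (𝓔.E.flip.obj A).map c.op + (𝓔.E.flip.obj A).map d.op := Functor.map_add _
  exact congrArg (fun f => f.hom δ) h

@[simp] theorem push_zero_left {D A A' : C} (δ : 𝓔.Ext D A) :
    𝓔.push (0 : A ⟶ A') δ = 0 := by
  have h := 𝓔.push_add (0 : A ⟶ A') 0 δ
  simpa using h

@[simp] theorem pull_zero_left {D D' A : C} (δ : 𝓔.Ext D A) :
    𝓔.pull (0 : D' ⟶ D) δ = 0 := by
  have h := 𝓔.pull_add (0 : D' ⟶ D) 0 δ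
  simpa using h

theorem push_neg {D A A' : C} (a : A ⟶ A') (δ : 𝓔.Ext D A) :
    𝓔.push (-a) δ = -𝓔.push a δ := by
  refine eq_neg_of_add_eq_zero_left ?_
  rw [← push_add, neg_add_cancel, push_zero_left]

theorem push_sum {D A A' : C} {ι : Type*} (s : Finset ι) (a : ι → (A ⟶ A')) (δ : 𝓔.Ext D A) :
    𝓔.push (∑ i ∈ s, a i) δ = ∑ i ∈ s, 𝓔.push (a i) δ := by
  classical
  induction s using Finset.induction_on with
  | empty => simp
  | insert i s hi ih => rw [Finset.sum_insert hi, Finset.sum_insert hi, push_add, ih]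

variable {𝓔}

theorem Realizes.congr_iso {A B B' D : C} {x : A ⟶ B} {y : B ⟶ D} {δ : 𝓔.Ext D A}
    (h : 𝓔.Realizes x y δ) (e : B ≅ B') : 𝓔.Realizes (x ≫ e.hom) (e.inv ≫ y) δ :=
  Eq.trans h (Quotient.sound ⟨e, rfl, by simp⟩)

theorem Realizes.exists_iso {A B B' D : C} {x : A ⟶ B} {y : B ⟶ D} {x' : A ⟶ B'} {y' : B' ⟶ D}
    {δ : 𝓔.Ext D A} (h : 𝓔.Realizes x y δ) (h' : 𝓔.Realizes x' y' δ) :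
    ∃ e : B ≅ B', x ≫ e.hom = x' ∧ e.hom ≫ y' = y :=
  Quotient.exact (Eq.trans (Eq.symm h) h')

end ExtriangulatedData

namespace IsExtriangulated

variable [HasBinaryBiproducts C] {𝓔 : ExtriangulatedData.{w} C} (h𝓔 : IsExtriangulated 𝓔)
include h𝓔

theorem realizes_id_zero (A : C) {Z : C} (hZ : IsZero Z) :
    𝓔.Realizes (𝟙 A) (0 : A ⟶ Z) 0 := by
  have e : IsIso (biprod.inl : A ⟶ A ⊞ Z) := by
    refine ⟨biprod.fst, by simp, ?_⟩
    ext <;> simp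
    exact hZ.eq_of_src _ _
  have h := (h𝓔.realizes_zero A Z).congr_iso (asIso (biprod.inl : A ⟶ A ⊞ Z)).symm
  convert h using 1
  · simp
  · exact hZ.eq_of_tgt _ _

theorem realizes_zero_id (A : C) {Z : C} (hZ : IsZero Z) :
    𝓔.Realizes (0 : Z ⟶ A) (𝟙 A) 0 := by
  have e : IsIso (biprod.snd : Z ⊞ A ⟶ A) := by
    refine ⟨biprod.inr, ?_, by simp⟩
    ext <;> simp
    exact hZ.eq_of_src _ _
  have h := (h𝓔.realizes_zero Z A).congr_iso (asIso (biprod.snd : Z ⊞ A ⟶ A))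
  convert h using 1
  · exact hZ.eq_of_src _ _
  · simp

variable {A B D : C} {x : A ⟶ B} {y : B ⟶ D} {δ : 𝓔.Ext D A}

/-- The morphism of extensions `(f, 𝟙)` from `δ` to `0` is realized by a map into the split middle
term, whose first component is the extension of `f`. -/
theorem exists_ext_of_push_eq_zero (h : 𝓔.Realizes x y δ) {V : C} (f : A ⟶ V)
    (hf : 𝓔.push f δ = 0) : ∃ g : B ⟶ V, x ≫ g = f := by
  obtain ⟨b, hb, -⟩ := h𝓔.realization h (h𝓔.realizes_zero V D) f (𝟙 D) (by simp [hf])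
  exact ⟨b ≫ biprod.fst, by simp [reassoc_of% hb]⟩

theorem exists_lift_of_pull_eq_zero (h : 𝓔.Realizes x y δ) {V : C} (f : V ⟶ D)
    (hf : 𝓔.pull f δ = 0) : ∃ g : V ⟶ B, g ≫ y = f := by
  obtain ⟨b, -, hb⟩ := h𝓔.realization (h𝓔.realizes_zero A V) h (𝟙 A) f (by simp [hf])
  exact ⟨biprod.inr ≫ b, by simp [← hb]⟩

variable [HasZeroObject C]

/-- Here and in the next lemmas, (ET3) and its dual are applied against the trivial triangles `A ⟶ A
⟶ 0` and `0 ⟶ A ⟶ A`, which realize zero. -/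
theorem push_inf (h : 𝓔.Realizes x y δ) : 𝓔.push x δ = 0 := by
  obtain ⟨c, -, hc⟩ := h𝓔.et3 h (h𝓔.realizes_id_zero B (isZero_zero C)) x (𝟙 B) (by simp)
  rw [hc, 𝓔.pull_zero_right]

theorem pull_defl (h : 𝓔.Realizes x y δ) : 𝓔.pull y δ = 0 := by
  obtain ⟨a, -, hc⟩ := h𝓔.et3_op (h𝓔.realizes_zero_id B (isZero_zero C)) h (𝟙 B) y (by simp)
  rw [← hc, 𝓔.push_zero_right]

theorem comp_eq_zero (h : 𝓔.Realizes x y δ) : x ≫ y = 0 := by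
  obtain ⟨c, hc, -⟩ := h𝓔.et3 (h𝓔.realizes_id_zero A (isZero_zero C)) h (𝟙 A) x (by simp)
  simpa using hc.symm

theorem exists_desc (h : 𝓔.Realizes x y δ) {V : C} (g : B ⟶ V) (hg : x ≫ g = 0) :
    ∃ c : D ⟶ V, y ≫ c = g := by
  obtain ⟨c, hc, -⟩ := h𝓔.et3 h (h𝓔.realizes_zero_id V (isZero_zero C)) 0 g (by simp [hg])
  exact ⟨c, by simpa using hc⟩

theorem exists_lift (h : 𝓔.Realizes x y δ) {V : C} (g : V ⟶ B) (hg : g ≫ y = 0) :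
    ∃ a : V ⟶ A, a ≫ x = g := by
  obtain ⟨a, ha, -⟩ := h𝓔.et3_op (h𝓔.realizes_id_zero V (isZero_zero C)) h g 0 (by simp [hg])
  exact ⟨a, by simpa using ha.symm⟩

theorem eq_zero_of_retraction (h : 𝓔.Realizes x y δ) {r : B ⟶ A} (hr : x ≫ r = 𝟙 A) : δ = 0 := by
  rw [← 𝓔.push_id δ, ← hr, 𝓔.push_comp, h𝓔.push_inf h, 𝓔.push_zero_right]

theorem eq_zero_of_section (h : 𝓔.Realizes x y δ) {s : D ⟶ B} (hs : s ≫ y = 𝟙 D) : δ = 0 := by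
  rw [← 𝓔.pull_id δ, ← hs, 𝓔.pull_comp, h𝓔.pull_defl h, 𝓔.pull_zero_right]

theorem isIso_inf_of_isZero (h : 𝓔.Realizes x y δ) (hD : IsZero D) : IsIso x := by
  have hδ : δ = 0 := by
    rw [← 𝓔.pull_id δ, hD.eq_of_src (𝟙 D) 0, 𝓔.pull_zero_left]
  obtain ⟨g, hg⟩ := h𝓔.exists_ext_of_push_eq_zero h (𝟙 A) (by simp [hδ])
  obtain ⟨c, hc⟩ := h𝓔.exists_desc h (g ≫ x - 𝟙 B) (by simp [reassoc_of% hg])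
  refine ⟨g, hg, ?_⟩
  rw [hD.eq_of_src c 0, comp_zero] at hc
  exact (sub_eq_zero.1 hc.symm)

theorem isIso_defl_of_isZero (h : 𝓔.Realizes x y δ) (hA : IsZero A) : IsIso y := by
  have hδ : δ = 0 := by
    rw [← 𝓔.push_id δ, hA.eq_of_src (𝟙 A) 0, 𝓔.push_zero_left]
  obtain ⟨g, hg⟩ := h𝓔.exists_lift_of_pull_eq_zero h (𝟙 D) (by simp [hδ])
  obtain ⟨c, hc⟩ := h𝓔.exists_lift h (y ≫ g - 𝟙 B) (by simp [hg])
  refine ⟨g, ?_, hg⟩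
  rw [hA.eq_of_tgt c 0, zero_comp] at hc
  exact (sub_eq_zero.1 hc.symm)

end IsExtriangulated

end Exactness

/-! ### Objects with local endomorphism rings and Krull–Schmidt decompositions. -/

section LocalObjects

variable {C : Type u} [Category.{v} C] [Preadditive C]

theorem exists_isIso_of_isIso_sum {X : C} [IsLocalRing (End X)] {ι : Type*} {s : Finset ι}
    {a : ι → (X ⟶ X)} (h : IsIso (∑ i ∈ s, a i)) : ∃ i ∈ s, IsIso (a i) := by
  obtain ⟨i, hi, hu⟩ := IsLocalRing.exists_of_isUnit_sum (R := End X) (f := a) (s := s)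
    ((isUnit_iff_isIso _).2 h)
  exact ⟨i, hi, (isUnit_iff_isIso _).1 hu⟩

theorem isIso_or_isIso_of_add_eq_id {X : C} [IsLocalRing (End X)] {a b : X ⟶ X}
    (h : a + b = 𝟙 X) : IsIso a ∨ IsIso b := by
  rcases IsLocalRing.isUnit_or_isUnit_of_add_one (R := End X) (a := a) (b := b) h with h | h
  · exact Or.inl ((isUnit_iff_isIso _).1 h)
  · exact Or.inr ((isUnit_iff_isIso _).1 h)

theorem not_isZero_of_isLocalRing (X : C) [IsLocalRing (End X)] : ¬ IsZero X := by
  intro h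
  exact one_ne_zero (α := End X) (h.eq_of_src _ _)

/-- In the local ring `End Y`, the idempotent `r ≫ i` or its complement is invertible. In the first
case `r ≫ i` is the identity; in the second `i = 0`. -/
theorem isIso_of_isSplitMono_of_local {X Y : C} [IsLocalRing (End Y)] (hX : ¬ IsZero X)
    {i : X ⟶ Y} {r : Y ⟶ X} (h : i ≫ r = 𝟙 X) : IsIso i := by
  rcases isIso_or_isIso_of_add_eq_id (X := Y) (a := r ≫ i) (b := 𝟙 Y - r ≫ i) (by simp) with h' | h'
  · refine ⟨r, h, ?_⟩
    rw [← cancel_mono (r ≫ i), Category.assoc, reassoc_of% h, Category.id_comp]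
  · refine absurd ?_ hX
    have : i = 0 := by
      rw [← cancel_mono (𝟙 Y - r ≫ i)]
      simp [reassoc_of% h]
    rw [IsZero.iff_id_eq_zero, ← h, this, zero_comp]

theorem indecomposable_of_isLocalRing [HasBinaryBiproducts C] (X : C) [IsLocalRing (End X)] :
    Indecomposable X := by
  refine ⟨not_isZero_of_isLocalRing X, fun Y Z e => ?_⟩
  by_contra! hYZ
  have hi : (biprod.inl ≫ e.inv) ≫ (e.hom ≫ biprod.fst) = 𝟙 Y := by simp
  have := isIso_of_isSplitMono_of_local hYZ.1 hi
  refine hYZ.2 ?_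
  have h0 : (biprod.inl ≫ e.inv) ≫ (e.hom ≫ biprod.snd : X ⟶ Z) = 0 := by simp
  have h1 : (e.hom ≫ biprod.snd : X ⟶ Z) = 0 := by
    rw [← cancel_epi (biprod.inl ≫ e.inv), h0, comp_zero]
  rw [IsZero.iff_id_eq_zero]
  have : (biprod.inr ≫ e.inv) ≫ (e.hom ≫ biprod.snd : X ⟶ Z) = 𝟙 Z := by simp
  rw [← this, h1, comp_zero]

theorem isLocalRing_end_of_iso {X Y : C} (e : X ≅ Y) [IsLocalRing (End X)] :
    IsLocalRing (End Y) := by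
  have : Nontrivial (End Y) := by
    refine ⟨⟨𝟙 Y, 0, fun h => not_isZero_of_isLocalRing X ?_⟩⟩
    exact IsZero.of_iso ((IsZero.iff_id_eq_zero Y).2 h) e
  refine ⟨fun {a b} hab => ?_⟩
  have h : e.hom ≫ (a : Y ⟶ Y) ≫ e.inv + e.hom ≫ (b : Y ⟶ Y) ≫ e.inv = 𝟙 X := by
    rw [← Preadditive.comp_add, ← Preadditive.add_comp]
    have : (a : Y ⟶ Y) + b = 𝟙 Y := hab
    simp [this]
  have key : ∀ c : Y ⟶ Y, IsIso (e.hom ≫ c ≫ e.inv) → IsUnit (show End Y from c) := by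
    intro c hc
    rw [isUnit_iff_isIso]
    have : c = e.inv ≫ (e.hom ≫ c ≫ e.inv) ≫ e.hom := by simp
    change IsIso c
    rw [this]
    infer_instance
  exact (isIso_or_isIso_of_add_eq_id h).imp (key a) (key b)

/-- If an object with local endomorphism ring is a retract of a biproduct, then it is a retract of
one of the two summands. -/
theorem isIso_or_isIso_of_biprod [HasBinaryBiproducts C] {X Y Z : C} [IsLocalRing (End X)]
    {i : X ⟶ Y ⊞ Z} {r : Y ⊞ Z ⟶ X} (h : i ≫ r = 𝟙 X) :
    IsIso ((i ≫ biprod.fst) ≫ (biprod.inl ≫ r)) ∨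
      IsIso ((i ≫ biprod.snd) ≫ (biprod.inr ≫ r)) := by
  refine isIso_or_isIso_of_add_eq_id ?_
  have : i ≫ (biprod.fst ≫ biprod.inl + biprod.snd ≫ biprod.inr) ≫ r = 𝟙 X := by
    rw [biprod.total, Category.id_comp, h]
  rw [← this]
  simp only [Preadditive.add_comp, Preadditive.comp_add, Category.assoc]

theorem exists_isIso_of_biproduct [HasFiniteBiproducts C] {X : C} [IsLocalRing (End X)]
    {J : Type} [Fintype J] {Y : J → C} {i : X ⟶ ⨁ Y} {r : ⨁ Y ⟶ X} (h : i ≫ r = 𝟙 X) :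
    ∃ k, IsIso ((i ≫ biproduct.π Y k) ≫ (biproduct.ι Y k ≫ r)) := by
  have h' : ∑ k, (i ≫ biproduct.π Y k) ≫ (biproduct.ι Y k ≫ r) = 𝟙 X := by
    have : i ≫ (∑ k, biproduct.π Y k ≫ biproduct.ι Y k) ≫ r = 𝟙 X := by
      rw [biproduct.total, Category.id_comp, h]
    rw [← this, Preadditive.sum_comp, Preadditive.comp_sum]
    exact Finset.sum_congr rfl fun k _ => by simp
  obtain ⟨k, -, hk⟩ := exists_isIso_of_isIso_sum (s := Finset.univ)
    (a := fun k => (i ≫ biproduct.π Y k) ≫ (biproduct.ι Y k ≫ r))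
    (by rw [h']; infer_instance)
  exact ⟨k, hk⟩

/-- Splitting off one summand of a finite biproduct. -/
noncomputable def biproductIsoBiprod [HasFiniteBiproducts C] [HasBinaryBiproducts C]
    {J : Type} [Finite J] (Y : J → C) (k : J) :
    ⨁ Y ≅ Y k ⊞ ⨁ Subtype.restrict (fun j => j ≠ k) Y where
  hom := biprod.lift (biproduct.π Y k) (biproduct.toSubtype Y _)
  inv := biprod.desc (biproduct.ι Y k) (biproduct.fromSubtype Y _)
  hom_inv_id := by
    classical
    rw [biprod.lift_desc, biproduct.toSubtype_fromSubtype]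
    refine biproduct.hom_ext' _ _ fun j => ?_
    rw [Preadditive.comp_add, biproduct.ι_map]
    by_cases h : j = k
    · subst h
      simp
    · rw [biproduct.ι_π_ne_assoc _ h]
      simp [h]
  inv_hom_id := by
    classical
    have h1 : biproduct.ι Y k ≫ biproduct.toSubtype Y (fun j => j ≠ k) = 0 := by
      exact (biproduct.ι_toSubtype _ _ _).trans (dif_neg (not_not_intro rfl))
    have h2 : biproduct.fromSubtype Y (fun j => j ≠ k) ≫ biproduct.π Y k = 0 := by
      exact (biproduct.fromSubtype_π _ _ _).trans (dif_neg (not_not_intro rfl))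
    apply biprod.hom_ext' <;> apply biprod.hom_ext
    · simp
    · simp only [biprod.inl_desc_assoc, Category.assoc, biprod.lift_snd, h1, Category.comp_id,
        BinaryBicone.inl_snd]
    · simp only [biprod.inr_desc_assoc, Category.assoc, biprod.lift_fst, h2, Category.comp_id,
        BinaryBicone.inr_fst]
    · simp only [biprod.inr_desc_assoc, Category.assoc, biprod.lift_snd, Category.comp_id,
        BinaryBicone.inr_snd, biproduct.fromSubtype_toSubtype]

variable [HasFiniteBiproducts C] [HasBinaryBiproducts C]

/-- In a Krull-Schmidt category, an object with local endomorphism ring which is a retract of `D`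
has a complement in `D`. -/
theorem IsKrullSchmidt.exists_complement (hKS : IsKrullSchmidt C) {X D : C} [IsLocalRing (End X)]
    {i : X ⟶ D} {r : D ⟶ X} (h : i ≫ r = 𝟙 X) :
    ∃ (D₁ D₂ : C) (φ : D ≅ D₁ ⊞ D₂), IsIso (i ≫ φ.hom ≫ biprod.fst) := by
  obtain ⟨n, Y, hY, ⟨e⟩⟩ := hKS D
  obtain ⟨k, hk⟩ := exists_isIso_of_biproduct (i := i ≫ e.hom) (r := e.inv ≫ r) (by simp [h])
  have := hY k
  have hs : ((i ≫ e.hom) ≫ biproduct.π Y k) ≫ ((biproduct.ι Y k ≫ e.inv ≫ r) ≫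
      inv (((i ≫ e.hom) ≫ biproduct.π Y k) ≫ (biproduct.ι Y k ≫ e.inv ≫ r))) = 𝟙 X := by
    rw [← Category.assoc, IsIso.hom_inv_id]
  have := isIso_of_isSplitMono_of_local (not_isZero_of_isLocalRing X) hs
  refine ⟨_, _, e ≪≫ biproductIsoBiprod Y k, ?_⟩
  simpa [biproductIsoBiprod] using this

end LocalObjects

/-! ### Inflations, deflations and retracts in a length category. -/

section LengthCategories

variable {C : Type u} [Category.{v} C] [Preadditive C]

namespace LengthFunction

variable {𝓔 : ExtriangulatedData.{w} C} (Θ : LengthFunction 𝓔)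

theorem len_biprod [HasBinaryBiproducts C] (h𝓔 : IsExtriangulated 𝓔) (X Y : C) :
    Θ.len (X ⊞ Y) = Θ.len X + Θ.len Y :=
  Θ.len_split (h𝓔.realizes_zero X Y)

variable {Θ}

theorem IsInflation.len_le {X Y : C} {f : X ⟶ Y} (h : Θ.IsInflation f) : Θ.len X ≤ Θ.len Y := by
  obtain ⟨M, y, δ, -, hl⟩ := h
  omega

theorem IsDeflation.len_le {X Y : C} {f : X ⟶ Y} (h : Θ.IsDeflation f) : Θ.len Y ≤ Θ.len X := by
  obtain ⟨M, y, δ, -, hl⟩ := h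
  omega

variable [HasBinaryBiproducts C] (h𝓔 : IsExtriangulated 𝓔)
include h𝓔

/-- (ET4) gives a triangle for the composite and one for its cokernel `H`. The two subadditivity
bounds can only be equalities, as the lengths of the given stable triangles add up. -/
theorem IsInflation.comp {X Y Z : C} {f : X ⟶ Y} {g : Y ⟶ Z} (hf : Θ.IsInflation f)
    (hg : Θ.IsInflation g) : Θ.IsInflation (f ≫ g) := by
  obtain ⟨D, f', δ, hf, hfl⟩ := hf
  obtain ⟨F, g', δ', hg, hgl⟩ := hg
  obtain ⟨H, d, e, h, h', δ'', rfl, -, -, hr, hde, -, -⟩ := h𝓔.et4 hf hg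
  have h1 := Θ.len_le hr
  have h2 := Θ.len_le hde
  exact ⟨H, h', δ'', hr, by omega⟩

theorem IsDeflation.comp {X Y Z : C} {f : X ⟶ Y} {g : Y ⟶ Z} (hf : Θ.IsDeflation f)
    (hg : Θ.IsDeflation g) : Θ.IsDeflation (f ≫ g) := by
  obtain ⟨D, f', δ, hf, hfl⟩ := hf
  obtain ⟨F, g', δ', hg, hgl⟩ := hg
  obtain ⟨H, d, e, h', h, δ'', rfl, -, -, hr, hde, -, -⟩ := h𝓔.et4_op hf hg
  have h1 := Θ.len_le hr
  have h2 := Θ.len_le hde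
  exact ⟨H, h', δ'', hr, by omega⟩

variable [HasZeroObject C]

theorem IsInflation.isIso {X Y : C} {f : X ⟶ Y} (h : Θ.IsInflation f)
    (hl : Θ.len Y ≤ Θ.len X) : IsIso f := by
  obtain ⟨M, y, δ, hr, hl'⟩ := h
  exact h𝓔.isIso_inf_of_isZero hr ((Θ.len_eq_zero M).1 (by omega))

theorem IsDeflation.isIso {X Y : C} {f : X ⟶ Y} (h : Θ.IsDeflation f)
    (hl : Θ.len X ≤ Θ.len Y) : IsIso f := by
  obtain ⟨M, y, δ, hr, hl'⟩ := h
  exact h𝓔.isIso_defl_of_isZero hr ((Θ.len_eq_zero M).1 (by omega))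

variable (Θ) in
theorem isInflation_of_isIso {X Y : C} (f : X ⟶ Y) [IsIso f] : Θ.IsInflation f := by
  have h := (h𝓔.realizes_id_zero X (isZero_zero C)).congr_iso (asIso f)
  rw [Category.id_comp] at h
  exact ⟨_, _, _, h, Θ.len_split h⟩

variable (Θ) in
theorem isDeflation_of_isIso {X Y : C} (f : X ⟶ Y) [IsIso f] : Θ.IsDeflation f := by
  have h := (h𝓔.realizes_zero_id Y (isZero_zero C)).congr_iso (asIso f).symm
  simp only [asIso_hom, Iso.symm_inv, Category.comp_id] at h
  exact ⟨_, _, _, h, Θ.len_split h⟩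

end LengthFunction

variable [HasBinaryBiproducts C] [HasFiniteBiproducts C]

/-- A Krull-Schmidt extriangulated category with a length function which makes it a length
category. -/
structure LengthFunction.IsKrullSchmidtLength {𝓔 : ExtriangulatedData.{w} C}
    (Θ : LengthFunction 𝓔) : Prop where
  krullSchmidt : IsKrullSchmidt C
  extri : IsExtriangulated 𝓔
  admissible : Θ.IsLengthCategory

namespace LengthFunction.IsKrullSchmidtLength

variable {𝓔 : ExtriangulatedData.{w} C} {Θ : LengthFunction 𝓔} (H : Θ.IsKrullSchmidtLength)
include H

theorem len_biprod (X Y : C) : Θ.len (X ⊞ Y) = Θ.len X + Θ.len Y := Θ.len_biprod H.extri X Y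

/-- Splitting of idempotents is only derived later, from this bound. So the local summands are
cancelled one at a time, using the Krull–Schmidt property. -/
theorem len_biproduct_le_of_retract {J : Type} [Finite J] {Y : J → C}
    (hY : ∀ j, IsLocalRing (End (Y j))) {D : C} {i : ⨁ Y ⟶ D} {r : D ⟶ ⨁ Y} (h : i ≫ r = 𝟙 _) :
    Θ.len (⨁ Y) ≤ Θ.len D := by
  induction hn : Nat.card J generalizing J D with
  | zero =>
    have : IsEmpty J := (Nat.card_eq_zero.1 hn).resolve_right (by simpa using ‹Finite J›)
    have : IsZero (⨁ Y) := by
      rw [IsZero.iff_id_eq_zero]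
      ext j
      exact this.elim j
    rw [(Θ.len_eq_zero _).2 this]
    exact Nat.zero_le _
  | succ n ih =>
    have : Nonempty J := (Nat.card_pos_iff.1 (by omega)).1
    obtain ⟨k⟩ := this
    have := hY k
    let e := biproductIsoBiprod Y k
    have hk : (biprod.inl ≫ e.inv ≫ i) ≫ (r ≫ e.hom ≫ biprod.fst) = 𝟙 (Y k) := by
      simp [reassoc_of% h]
    obtain ⟨D₁, D₂, φ, hφ⟩ := H.krullSchmidt.exists_complement hk
    have : IsIso (biprod.inl ≫ (e.inv ≫ i ≫ φ.hom) ≫ biprod.fst) := by simpa using hφ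
    -- The corner is invertible, so Gaussian elimination makes the section diagonal; the remaining
    -- entry `g` is again a section.
    obtain ⟨L, R, g, hg⟩ := Biprod.gaussian (e.inv ≫ i ≫ φ.hom)
    have hgi : g = biprod.inr ≫ (L.hom ≫ (e.inv ≫ i ≫ φ.hom) ≫ R.hom) ≫ biprod.snd := by
      rw [hg]; simp
    have hret : (biprod.inr ≫ (L.hom ≫ (e.inv ≫ i ≫ φ.hom) ≫ R.hom)) ≫
        (R.inv ≫ φ.inv ≫ r ≫ e.hom ≫ L.inv ≫ biprod.snd) = 𝟙 _ := by
      simp [reassoc_of% h]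
    have hret' : g ≫ biprod.inr ≫ (R.inv ≫ φ.inv ≫ r ≫ e.hom ≫ L.inv ≫ biprod.snd) = 𝟙 _ := by
      rw [hg, biprod.inr_map, Category.assoc] at hret
      exact hret
    have hcard : Nat.card {j : J // j ≠ k} = n := by
      have := Fintype.ofFinite J
      classical
      rw [Nat.card_eq_fintype_card] at hn ⊢
      simp [Fintype.card_subtype_compl, hn]
    have hle : Θ.len (⨁ Subtype.restrict (fun j => j ≠ k) Y) ≤ Θ.len D₂ := ih (fun j : {j : J // j ≠ k} => hY j.1) (i := g) hret' hcard
    have h1 := Θ.len_iso e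
    have h2 := Θ.len_iso φ
    have h3 := Θ.len_iso (asIso (biprod.inl ≫ (e.inv ≫ i ≫ φ.hom) ≫ biprod.fst))
    rw [H.len_biprod] at h1 h2
    omega

theorem len_le_of_retract {X Y : C} {i : X ⟶ Y} {r : Y ⟶ X} (h : i ≫ r = 𝟙 X) :
    Θ.len X ≤ Θ.len Y := by
  obtain ⟨n, Z, hZ, ⟨e⟩⟩ := H.krullSchmidt X
  rw [Θ.len_iso e]
  exact H.len_biproduct_le_of_retract hZ (i := e.inv ≫ i) (r := r ≫ e.hom) (by simp [reassoc_of% h])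

/-- The identity of `Y` factors through the cokernel `D`, so `Y` is a retract of `D` and cannot be
longer. -/
theorem isZero_of_zero_isInflation {X Y : C} (h : Θ.IsInflation (0 : X ⟶ Y)) : IsZero X := by
  obtain ⟨D, y, δ, hr, hl⟩ := h
  obtain ⟨c, hc⟩ := H.extri.exists_desc hr (𝟙 Y) (by simp)
  have := H.len_le_of_retract hc
  exact (Θ.len_eq_zero X).1 (by omega)

theorem isZero_of_zero_isDeflation {X Y : C} (h : Θ.IsDeflation (0 : X ⟶ Y)) : IsZero Y := by
  obtain ⟨D, y, δ, hr, hl⟩ := h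
  obtain ⟨c, hc⟩ := H.extri.exists_lift hr (𝟙 X) (by simp)
  have := H.len_le_of_retract hc
  exact (Θ.len_eq_zero Y).1 (by omega)

/-- The kernel of the deflation part of `f` embeds into `Z` by a zero inflation, hence vanishes. -/
theorem isInflation_of_comp {X Y Z : C} {f : X ⟶ Y} {g : Y ⟶ Z} (h : Θ.IsInflation (f ≫ g)) :
    Θ.IsInflation f := by
  obtain ⟨W, d, j, ⟨K, k, δ, hr, hl⟩, hj, rfl⟩ := H.admissible f
  have hk : Θ.IsInflation k := ⟨W, d, δ, hr, hl⟩
  have h0 := hk.comp H.extri h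
  have hkd := H.extri.comp_eq_zero hr
  simp only [Category.assoc, reassoc_of% hkd, zero_comp] at h0
  have := H.extri.isIso_defl_of_isZero hr (H.isZero_of_zero_isInflation h0)
  exact (Θ.isInflation_of_isIso H.extri d).comp H.extri hj

theorem isDeflation_of_comp {X Y Z : C} {f : X ⟶ Y} {g : Y ⟶ Z} (h : Θ.IsDeflation (f ≫ g)) :
    Θ.IsDeflation g := by
  obtain ⟨W, d, j, hd, ⟨K, k, δ, hr, hl⟩, rfl⟩ := H.admissible g
  have hk : Θ.IsDeflation k := ⟨W, j, δ, hr, hl⟩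
  have h0 := h.comp H.extri hk
  simp only [Category.assoc, H.extri.comp_eq_zero hr, comp_zero] at h0
  have := H.extri.isIso_inf_of_isZero hr (H.isZero_of_zero_isDeflation h0)
  exact hd.comp H.extri (Θ.isDeflation_of_isIso H.extri j)

theorem isInflation_of_retract {X Y : C} {i : X ⟶ Y} {r : Y ⟶ X} (h : i ≫ r = 𝟙 X) :
    Θ.IsInflation i :=
  H.isInflation_of_comp (g := r) (by rw [h]; exact Θ.isInflation_of_isIso H.extri _)

theorem isDeflation_of_retract {X Y : C} {i : X ⟶ Y} {r : Y ⟶ X} (h : i ≫ r = 𝟙 X) :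
    Θ.IsDeflation r :=
  H.isDeflation_of_comp (f := i) (by rw [h]; exact Θ.isDeflation_of_isIso H.extri _)

/-- Idempotents split: a retract is a direct summand, and the section can be taken to be the
inclusion. -/
theorem exists_iso_biprod_of_section {X Y : C} {i : X ⟶ Y} {r : Y ⟶ X} (h : i ≫ r = 𝟙 X) :
    ∃ (Z : C) (e : X ⊞ Z ≅ Y), biprod.inl ≫ e.hom = i := by
  obtain ⟨Z, y, δ, hr, -⟩ := H.isInflation_of_retract h
  obtain rfl := H.extri.eq_zero_of_retraction hr h
  obtain ⟨e, he, -⟩ := (H.extri.realizes_zero X Z).exists_iso hr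
  exact ⟨Z, e, he⟩

/-- Idempotents split: a retract is a direct summand, and the retraction can be taken to be the
projection. -/
theorem exists_iso_biprod_of_retraction {X Y : C} {i : X ⟶ Y} {r : Y ⟶ X} (h : i ≫ r = 𝟙 X) :
    ∃ (Z : C) (e : Y ≅ Z ⊞ X), e.hom ≫ biprod.snd = r := by
  obtain ⟨Z, x, δ, hr, -⟩ := H.isDeflation_of_retract h
  obtain rfl := H.extri.eq_zero_of_section hr h
  obtain ⟨e, -, he⟩ := hr.exists_iso (H.extri.realizes_zero Z X)
  exact ⟨Z, e, he⟩

theorem isIso_of_retract_of_indecomposable {X Y : C} (hY : Indecomposable Y) (hX : ¬ IsZero X)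
    {i : X ⟶ Y} {r : Y ⟶ X} (h : i ≫ r = 𝟙 X) : IsIso i := by
  obtain ⟨Z, e, rfl⟩ := H.exists_iso_biprod_of_section h
  have hZ := (hY.2 X Z e.symm).resolve_left hX
  have : IsIso (biprod.inl : X ⟶ X ⊞ Z) :=
    H.extri.isIso_inf_of_isZero (H.extri.realizes_zero X Z) hZ
  infer_instance

/-- Every nonzero object has a retract with local endomorphism ring. -/
theorem exists_local_retract {Y : C} (hY : ¬ IsZero Y) :
    ∃ (X : C) (i : X ⟶ Y) (r : Y ⟶ X), IsLocalRing (End X) ∧ i ≫ r = 𝟙 X := by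
  obtain ⟨n, Z, hZ, ⟨e⟩⟩ := H.krullSchmidt Y
  rcases n with _ | n
  · refine absurd (IsZero.of_iso ?_ e) hY
    rw [IsZero.iff_id_eq_zero]
    ext j
    exact j.elim0
  · exact ⟨Z 0, biproduct.ι Z 0 ≫ e.inv, e.hom ≫ biproduct.π Z 0, hZ 0, by simp⟩

theorem isLocalRing_end {X : C} (hX : Indecomposable X) : IsLocalRing (End X) := by
  obtain ⟨Y, i, r, hY, h⟩ := H.exists_local_retract hX.1
  have := H.isIso_of_retract_of_indecomposable hX (not_isZero_of_isLocalRing Y) h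
  exact isLocalRing_end_of_iso (asIso i)

theorem exists_indecomposable_retract {Y : C} (hY : ¬ IsZero Y) :
    ∃ (X : C) (i : X ⟶ Y) (r : Y ⟶ X), Indecomposable X ∧ i ≫ r = 𝟙 X := by
  obtain ⟨X, i, r, hX, h⟩ := H.exists_local_retract hY
  exact ⟨X, i, r, indecomposable_of_isLocalRing X, h⟩

theorem len_biproduct {J : Type} [Fintype J] (Y : J → C) :
    Θ.len (⨁ Y) = ∑ j, Θ.len (Y j) := by
  classical
  induction hn : Fintype.card J generalizing J with
  | zero =>
    have : IsEmpty J := Fintype.card_eq_zero_iff.1 hn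
    have : IsZero (⨁ Y) := by
      rw [IsZero.iff_id_eq_zero]
      ext j
      exact this.elim j
    rw [(Θ.len_eq_zero _).2 this, Finset.univ_eq_empty, Finset.sum_empty]
  | succ n ih =>
    have : Nonempty J := Fintype.card_pos_iff.1 (by omega)
    obtain ⟨k⟩ := this
    have hcard : Fintype.card {j : J // j ≠ k} = n := by
      simp [Fintype.card_subtype_compl, hn]
    have h1 := Θ.len_iso (biproductIsoBiprod Y k)
    rw [H.len_biprod, ih _ hcard] at h1
    rw [h1, ← Finset.add_sum_erase _ _ (Finset.mem_univ k)]
    congr 1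
    exact (Finset.sum_subtype _ (by simp) fun j => Θ.len (Y j)).symm

end LengthFunction.IsKrullSchmidtLength

end LengthCategories

/-! ### The lexicographical order on finite sets of numbers. -/

section Lex

/-- The lexicographical order on finite sets of natural numbers, as a linear order. -/
def lexKey (I : Finset ℕ) : Colex (Finset ℕᵒᵈ) :=
  toColex (I.map OrderDual.toDual.toEmbedding)

theorem lexKey_injective : Function.Injective lexKey := by
  intro I J h
  exact Finset.map_injective _ (toColex_inj.1 h)

theorem lexLE_iff_lexKey (I J : Finset ℕ) : LexLE I J ↔ lexKey I ≤ lexKey J :=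
  lexLE_iff_colex I J

theorem lexKey_lt_iff (I J : Finset ℕ) :
    lexKey I < lexKey J ↔ ∃ d ∈ J, d ∉ I ∧ ∀ e < d, (e ∈ I ↔ e ∈ J) := by
  rw [lexKey, lexKey, Finset.Colex.lt_iff_exists_filter_lt]
  constructor
  · rintro ⟨w, hw, h⟩
    obtain ⟨d, rfl⟩ := OrderDual.toDual.surjective w
    simp only [Finset.mem_sdiff, Finset.mem_map_equiv] at hw
    refine ⟨d, hw.1, hw.2, fun e he => ?_⟩
    have := Finset.ext_iff.1 h (OrderDual.toDual e)
    simpa [Finset.mem_map_equiv, he] using this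
  · rintro ⟨d, hd, hd', h⟩
    refine ⟨OrderDual.toDual d, ?_, ?_⟩
    · simpa [Finset.mem_map_equiv] using ⟨hd, hd'⟩
    · ext w
      obtain ⟨e, rfl⟩ := OrderDual.toDual.surjective w
      simp only [Finset.mem_filter, Finset.mem_map_equiv,
        OrderDual.toDual_lt_toDual]
      exact and_congr_left fun he => h e he

theorem lexKey_empty_lt {J : Finset ℕ} (hJ : J.Nonempty) : lexKey ∅ < lexKey J := by
  rw [lexKey_lt_iff]
  refine ⟨J.min' hJ, J.min'_mem hJ, by simp, fun e he => ?_⟩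
  simp only [Finset.notMem_empty, false_iff]
  exact fun h => absurd (J.min'_le e h) (not_le.2 he)

/-- The first difference, which decides the comparison, is an element of `J` and hence lies below
`l`. -/
theorem lexKey_insert_lt {I J : Finset ℕ} {l : ℕ} (h : lexKey I < lexKey J) (hJ : ∀ n ∈ J, n < l) :
    lexKey (insert l I) < lexKey J := by
  rw [lexKey_lt_iff] at h ⊢
  obtain ⟨d, hd, hd', h⟩ := h
  have hdl := hJ d hd
  refine ⟨d, hd, by simp [hd', hdl.ne], fun e he => ?_⟩
  rw [Finset.mem_insert, ← h e he]
  simp [(he.trans hdl).ne]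

theorem lexKey_lt_insert {I : Finset ℕ} {l : ℕ} (h : ∀ n ∈ I, n < l) :
    lexKey I < lexKey (insert l I) := by
  rw [lexKey_lt_iff]
  refine ⟨l, Finset.mem_insert_self _ _, fun hl => (h l hl).false, fun e he => ?_⟩
  simp [he.ne]

end Lex

/-! ### Elementary properties of the Gabriel–Roiter measure. -/

section GabrielRoiter

variable {C : Type u} [Category.{v} C]

theorem isoClass_eq_iff {X Y : C} : isoClass X = isoClass Y ↔ Nonempty (X ≅ Y) :=
  Quotient.eq (r := isIsomorphicSetoid C)

theorem isoClass_eq_of_iso {X Y : C} (e : X ≅ Y) : isoClass X = isoClass Y :=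
  isoClass_eq_iff.2 ⟨e⟩

variable [Preadditive C]

/-- The isomorphism class of an indecomposable object. -/
def indClass [HasBinaryBiproducts C] {X : C} (hX : Indecomposable X) : IndClass C :=
  ⟨isoClass X, X, hX, rfl⟩

theorem indClass_eq_iff [HasBinaryBiproducts C] {X Y : C} {hX : Indecomposable X}
    {hY : Indecomposable Y} : indClass hX = indClass hY ↔ Nonempty (X ≅ Y) :=
  Subtype.ext_iff.trans isoClass_eq_iff

theorem exists_eq_indClass [HasBinaryBiproducts C] (c : IndClass C) :
    ∃ (X : C) (hX : Indecomposable X), indClass hX = c := by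
  obtain ⟨c, X, hX, rfl⟩ := c
  exact ⟨X, hX, rfl⟩

namespace LengthFunction

variable [HasBinaryBiproducts C] {𝓔 : ExtriangulatedData.{w} C} (Θ : LengthFunction 𝓔)

/-- The Gabriel-Roiter measure, as an element of a linear order. -/
noncomputable def grKey (c : IndClass C) : Colex (Finset ℕᵒᵈ) := lexKey (Θ.grMeasure c)

theorem le_grKey {c : IndClass C} {s : Finset (IndClass C)} (hs : s ∈ Θ.chainsTo c) :
    lexKey (s.image fun d => Θ.isoLen d.1) ≤ Θ.grKey c :=
  (lexLE_iff_lexKey _ _).1 ((Θ.grMeasure_spec c).2 _ ⟨s, hs, rfl⟩)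

theorem exists_chain_grMeasure (c : IndClass C) :
    ∃ s ∈ Θ.chainsTo c, s.image (fun d => Θ.isoLen d.1) = Θ.grMeasure c :=
  (Θ.grMeasure_spec c).1

theorem isoLen_le_of_mem_chain {c : IndClass C} {s : Finset (IndClass C)} (hs : s ∈ Θ.chainsTo c)
    {n : ℕ} (hn : n ∈ s.image fun d => Θ.isoLen d.1) : n ≤ Θ.isoLen c.1 := by
  obtain ⟨d, hd, rfl⟩ := Finset.mem_image.1 hn
  by_cases h : d = c
  · rw [h]
  · exact Θ.isoLen_le_of_sub (hs.2.2 d hd h)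

theorem le_isoLen_of_mem_grMeasure {c : IndClass C} {n : ℕ} (hn : n ∈ Θ.grMeasure c) :
    n ≤ Θ.isoLen c.1 := by
  obtain ⟨s, hs, h⟩ := Θ.exists_chain_grMeasure c
  rw [← h] at hn
  exact Θ.isoLen_le_of_mem_chain hs hn

theorem isoLen_mem_grMeasure (c : IndClass C) : Θ.isoLen c.1 ∈ Θ.grMeasure c := by
  obtain ⟨s, hs, h⟩ := Θ.exists_chain_grMeasure c
  rw [← h]
  exact Finset.mem_image_of_mem _ hs.2.1

/-- The length is the largest element of the measure. -/
theorem isoLen_eq_of_grKey_eq {c d : IndClass C} (h : Θ.grKey c = Θ.grKey d) :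
    Θ.isoLen c.1 = Θ.isoLen d.1 := by
  have h := lexKey_injective h
  apply le_antisymm
  · exact Θ.le_isoLen_of_mem_grMeasure (h ▸ Θ.isoLen_mem_grMeasure c)
  · exact Θ.le_isoLen_of_mem_grMeasure (h ▸ Θ.isoLen_mem_grMeasure d)

variable {Θ} [HasZeroObject C] (h𝓔 : IsExtriangulated 𝓔)
include h𝓔

theorem sub_iff {X Y : C} :
    Θ.Sub (isoClass X) (isoClass Y) ↔ ∃ f : X ⟶ Y, Θ.IsInflation f := by
  constructor
  · rintro ⟨X', Y', f, hX, hY, hf⟩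
    obtain ⟨e⟩ := isoClass_eq_iff.1 hX
    obtain ⟨e'⟩ := isoClass_eq_iff.1 hY
    exact ⟨e.inv ≫ f ≫ e'.hom, (Θ.isInflation_of_isIso h𝓔 _).comp h𝓔
      (hf.comp h𝓔 (Θ.isInflation_of_isIso h𝓔 _))⟩
  · rintro ⟨f, hf⟩
    exact ⟨X, Y, f, rfl, rfl, hf⟩

theorem Sub.trans {a b c : IsoClass C} (hab : Θ.Sub a b) (hbc : Θ.Sub b c) : Θ.Sub a c := by
  induction a using Quotient.ind with | _ X
  induction b using Quotient.ind with | _ Y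
  induction c using Quotient.ind with | _ Z
  obtain ⟨f, hf⟩ := (sub_iff h𝓔).1 hab
  obtain ⟨g, hg⟩ := (sub_iff h𝓔).1 hbc
  exact (sub_iff h𝓔).2 ⟨f ≫ g, hf.comp h𝓔 hg⟩

theorem Sub.eq {a b : IsoClass C} (hab : Θ.Sub a b) (hl : Θ.isoLen b ≤ Θ.isoLen a) : a = b := by
  induction a using Quotient.ind with | _ X
  induction b using Quotient.ind with | _ Y
  obtain ⟨f, hf⟩ := (sub_iff h𝓔).1 hab
  have := hf.isIso h𝓔 hl
  exact isoClass_eq_of_iso (asIso f)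

theorem grKey_lt_of_sub {c d : IndClass C} (h : Θ.Sub c.1 d.1)
    (hl : Θ.isoLen c.1 < Θ.isoLen d.1) : Θ.grKey c < Θ.grKey d := by
  classical
  obtain ⟨s, hs, hsc⟩ := Θ.exists_chain_grMeasure c
  have hsub : ∀ a ∈ s, Θ.Sub a.1 d.1 := fun a ha => by
    by_cases hac : a = c
    · rwa [hac]
    · exact Sub.trans h𝓔 (hs.2.2 a ha hac) h
  have hins : insert d s ∈ Θ.chainsTo d := by
    refine ⟨?_, Finset.mem_insert_self _ _, fun a ha had => ?_⟩
    · rw [Finset.coe_insert]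
      exact hs.1.insert fun a ha _ => Or.inr (hsub a ha)
    · exact hsub a ((Finset.mem_insert.1 ha).resolve_left had)
  refine lt_of_lt_of_le ?_ (Θ.le_grKey hins)
  rw [grKey, ← hsc, Finset.image_insert]
  exact lexKey_lt_insert fun n hn => (Θ.isoLen_le_of_mem_chain hs hn).trans_lt hl

theorem grKey_le_of_sub {c d : IndClass C} (h : Θ.Sub c.1 d.1) : Θ.grKey c ≤ Θ.grKey d := by
  rcases lt_or_ge (Θ.isoLen c.1) (Θ.isoLen d.1) with hl | hl
  · exact (grKey_lt_of_sub h𝓔 h hl).le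
  · rw [Subtype.ext (Sub.eq h𝓔 h hl)]

/-- A comparison of the Gabriel-Roiter measure of `c` with measures of objects of smaller length
can be reduced to a proper subobject of `c`, if there is any. -/
theorem grKey_lt_or_exists_sub (c : IndClass C) :
    (∀ d : IndClass C, Θ.isoLen d.1 < Θ.isoLen c.1 → Θ.grKey c < Θ.grKey d) ∨
    ∃ c' : IndClass C, Θ.Sub c'.1 c.1 ∧ Θ.isoLen c'.1 < Θ.isoLen c.1 ∧
      ∀ d : IndClass C, Θ.isoLen d.1 < Θ.isoLen c.1 → Θ.grKey c' < Θ.grKey d →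
        Θ.grKey c < Θ.grKey d := by
  classical
  obtain ⟨s, hs, hsc⟩ := Θ.exists_chain_grMeasure c
  have hins : s.image (fun d => Θ.isoLen d.1) =
      insert (Θ.isoLen c.1) ((s.erase c).image fun d => Θ.isoLen d.1) := by
    conv_lhs => rw [← Finset.insert_erase hs.2.1, Finset.image_insert]
  have hlt : ∀ d : IndClass C, Θ.isoLen d.1 < Θ.isoLen c.1 → ∀ n ∈ Θ.grMeasure d,
    n < Θ.isoLen c.1 := fun d hd n hn => (Θ.le_isoLen_of_mem_grMeasure hn).trans_lt hd
  rcases (s.erase c).eq_empty_or_nonempty with h0 | hne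
  · left
    intro d hd
    rw [grKey, ← hsc, hins, h0]
    exact lexKey_insert_lt (lexKey_empty_lt ⟨_, Θ.isoLen_mem_grMeasure d⟩) (hlt d hd)
  · right
    -- The longest remaining member tops the chain with `c` removed, so the measure of `c'`
    -- dominates the lengths of that chain.
    obtain ⟨c', hc', hmax⟩ := Finset.exists_max_image (s.erase c) (fun d => Θ.isoLen d.1) hne
    obtain ⟨hne', hc's⟩ := Finset.mem_erase.1 hc'
    have hsub := hs.2.2 c' hc's hne'
    have hl : Θ.isoLen c'.1 < Θ.isoLen c.1 := by
      by_contra! hge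
      exact hne' (Subtype.ext (Sub.eq h𝓔 hsub hge))
    have hchain : s.erase c ∈ Θ.chainsTo c' := by
      refine ⟨hs.1.mono (by simp), hc', fun d hd hdc => ?_⟩
      rcases hs.1 (Finset.mem_of_mem_erase hd) hc's hdc with h | h
      · exact h
      · exact absurd (Subtype.ext (Sub.eq h𝓔 h (hmax d hd))).symm hdc
    refine ⟨c', hsub, hl, fun d hd hcd => ?_⟩
    rw [grKey, ← hsc, hins]
    exact lexKey_insert_lt ((Θ.le_grKey hchain).trans_lt hcd) (hlt d hd)

end LengthFunction

end GabrielRoiter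

/-! ### Gabriel's main property. -/

section MainProperty

variable {C : Type u} [Category.{v} C] [Preadditive C]
  [HasBinaryBiproducts C] [HasFiniteBiproducts C]

namespace LengthFunction.IsKrullSchmidtLength

variable {𝓔 : ExtriangulatedData.{w} C} {Θ : LengthFunction 𝓔} (H : Θ.IsKrullSchmidtLength)
include H

theorem grKey_le {X Y : C} (hX : Indecomposable X) (hY : Indecomposable Y) {f : X ⟶ Y}
    (hf : Θ.IsInflation f) : Θ.grKey (indClass hX) ≤ Θ.grKey (indClass hY) :=
  grKey_le_of_sub H.extri ⟨X, Y, f, rfl, rfl, hf⟩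

theorem grKey_lt {X Y : C} (hX : Indecomposable X) (hY : Indecomposable Y) {f : X ⟶ Y}
    (hf : Θ.IsInflation f) (hl : Θ.len X < Θ.len Y) :
    Θ.grKey (indClass hX) < Θ.grKey (indClass hY) :=
  grKey_lt_of_sub H.extri ⟨X, Y, f, rfl, rfl, hf⟩ hl

/-- The main property of the Gabriel-Roiter measure: if `X` is an indecomposable subobject of `Y`
and the measure of no indecomposable direct summand of `Y` exceeds that of `X`, then `X` is a
direct summand. -/
theorem exists_retraction_or_grKey_lt {X Y : C} (hX : Indecomposable X) {f : X ⟶ Y}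
    (hf : Θ.IsInflation f) :
    (∃ r : Y ⟶ X, f ≫ r = 𝟙 X) ∨
    ∃ (Y' : C) (hY' : Indecomposable Y') (i : Y' ⟶ Y) (r : Y ⟶ Y'), i ≫ r = 𝟙 Y' ∧
      Θ.grKey (indClass hX) < Θ.grKey (indClass hY') := by
  induction hn : Θ.len X + Θ.len Y using Nat.strong_induction_on generalizing X Y with
  | _ n ih =>
  have hXloc := H.isLocalRing_end hX
  by_cases hdefl : ∀ (Y' : C) (_ : Indecomposable Y') (i : Y' ⟶ Y) (r : Y ⟶ Y'),
      i ≫ r = 𝟙 Y' → Θ.IsDeflation (f ≫ r)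
  -- All components of `f` are deflations. If one hits a summand at least as long as `X`, it is
  -- invertible and `f` splits. Otherwise every summand is shorter than `X`, and the comparison
  -- passes to a proper subobject of `X` or is immediate.
  · by_cases hsmall : ∀ (Y' : C) (_ : Indecomposable Y') (i : Y' ⟶ Y) (r : Y ⟶ Y'),
      i ≫ r = 𝟙 Y' → Θ.len Y' < Θ.len X
    · rcases grKey_lt_or_exists_sub (Θ := Θ) H.extri (indClass hX) with h | ⟨c', hsub, hl, h⟩
      · have hY : ¬ IsZero Y := by
          intro h0
          have h1 := hf.len_le
          rw [(Θ.len_eq_zero Y).2 h0] at h1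
          exact hX.1 ((Θ.len_eq_zero X).1 (by omega))
        obtain ⟨Y', i, r, hY', hir⟩ := H.exists_indecomposable_retract hY
        exact Or.inr ⟨Y', hY', i, r, hir, h _ (hsmall Y' hY' i r hir)⟩
      · obtain ⟨X', hX', rfl⟩ := exists_eq_indClass c'
        obtain ⟨x, hx⟩ := (sub_iff H.extri).1 hsub
        change Θ.len X' < Θ.len X at hl
        rcases ih (Θ.len X' + Θ.len Y) (by omega) hX' (hx.comp H.extri hf) rfl with
          ⟨r, hr⟩ | ⟨Y', hY', i, r, hir, hlt⟩
        · have : IsIso x := H.isIso_of_retract_of_indecomposable hX hX'.1 (r := f ≫ r)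
            (by simpa using hr)
          exact absurd (Θ.len_iso (asIso x)) hl.ne
        · exact Or.inr ⟨Y', hY', i, r, hir, h _ (hsmall Y' hY' i r hir) hlt⟩
    · push Not at hsmall
      obtain ⟨Y', hY', i, r, hir, hl⟩ := hsmall
      have := (hdefl Y' hY' i r hir).isIso H.extri hl
      exact Or.inl ⟨r ≫ inv (f ≫ r), by rw [← Category.assoc, IsIso.hom_inv_id]⟩
  -- Replace the summand `Y₁` by the strictly shorter image `Z₁` of the bad component. Summands of
  -- `Z₁` have measure at most that of `Y₁`, so the induction hypothesis for `Y₂ ⊞ Z₁` transfers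
  -- back.
  · push Not at hdefl
    obtain ⟨Y₁, hY₁, i₁, r₁, hir₁, hdefl⟩ := hdefl
    obtain ⟨Y₂, e, he⟩ := H.exists_iso_biprod_of_retraction hir₁
    obtain ⟨Z₁, d, j, hd, hj, hdj⟩ := H.admissible (f ≫ r₁)
    have hlt : Θ.len Z₁ < Θ.len Y₁ := by
      by_contra! hge
      have := hj.isIso H.extri hge
      exact hdefl (hdj ▸ hd.comp H.extri (Θ.isDeflation_of_isIso H.extri j))
    have hfac : biprod.lift (f ≫ e.hom ≫ biprod.fst) d ≫ (biprod.map (𝟙 Y₂) j ≫ e.inv) = f := by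
      rw [← cancel_mono e.hom]
      ext <;> simp [hdj, he]
    have hf' : Θ.IsInflation (biprod.lift (f ≫ e.hom ≫ biprod.fst) d) :=
      H.isInflation_of_comp (hfac.symm ▸ hf)
    have hl := Θ.len_iso e
    rw [H.len_biprod] at hl
    have sub_of : ∀ {W : C} (hW : Indecomposable W) (g : W ⟶ Z₁), Θ.IsInflation g →
        Θ.grKey (indClass hW) ≤ Θ.grKey (indClass hY₁) :=
      fun hW g hg => H.grKey_le hW hY₁ (hg.comp H.extri hj)
    rcases ih (Θ.len X + Θ.len (Y₂ ⊞ Z₁)) (by rw [H.len_biprod]; omega) hX hf' rfl with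
      ⟨r, hr⟩ | ⟨Z, hZ, i, r, hir, hlt'⟩
    · rcases isIso_or_isIso_of_biprod hr with h | h
      · left
        refine ⟨e.hom ≫ biprod.fst ≫ biprod.inl ≫ r ≫ inv ((biprod.lift (f ≫ e.hom ≫ biprod.fst) d ≫
          biprod.fst) ≫ biprod.inl ≫ r), ?_⟩
        have := IsIso.hom_inv_id ((biprod.lift (f ≫ e.hom ≫ biprod.fst) d ≫
          biprod.fst) ≫ biprod.inl ≫ r)
        simpa only [biprod.lift_fst, Category.assoc] using this
      · have hd' : Θ.IsInflation d := by
          refine H.isInflation_of_retract (r := biprod.inr ≫ r ≫ inv ((biprod.lift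
            (f ≫ e.hom ≫ biprod.fst) d ≫ biprod.snd) ≫ biprod.inr ≫ r)) ?_
          have := IsIso.hom_inv_id ((biprod.lift (f ≫ e.hom ≫ biprod.fst) d ≫
            biprod.snd) ≫ biprod.inr ≫ r)
          simpa only [biprod.lift_snd, Category.assoc] using this
        have hdY : Θ.len X < Θ.len Y₁ := hd'.len_le.trans_lt hlt
        exact Or.inr ⟨Y₁, hY₁, i₁, r₁, hir₁, H.grKey_lt hX hY₁ (hd'.comp H.extri hj) hdY⟩
    · have hZloc := H.isLocalRing_end hZ
      rcases isIso_or_isIso_of_biprod hir with h | h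
      · refine Or.inr ⟨Z, hZ, i ≫ biprod.fst ≫ biprod.inl ≫ e.inv, e.hom ≫ biprod.fst ≫
          biprod.inl ≫ r ≫ inv ((i ≫ biprod.fst) ≫ biprod.inl ≫ r), ?_, hlt'⟩
        have := IsIso.hom_inv_id ((i ≫ biprod.fst) ≫ biprod.inl ≫ r)
        simp only [Category.assoc, Iso.inv_hom_id_assoc, BinaryBicone.inl_fst_assoc] at this ⊢
        exact this
      · refine Or.inr ⟨Y₁, hY₁, i₁, r₁, hir₁, hlt'.trans_le (sub_of hZ (i ≫ biprod.snd) ?_)⟩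
        refine H.isInflation_of_retract (r := biprod.inr ≫ r ≫
          inv ((i ≫ biprod.snd) ≫ biprod.inr ≫ r)) ?_
        have := IsIso.hom_inv_id ((i ≫ biprod.snd) ≫ biprod.inr ≫ r)
        simpa only [Category.assoc] using this

end LengthFunction.IsKrullSchmidtLength

end MainProperty

/-! ### Subobjects and quotients in `Θ₁`. -/

section SimpleObjects

variable {C : Type u} [Category.{v} C] [Preadditive C]

namespace LengthFunction

variable {𝓔 : ExtriangulatedData.{w} C} {Θ : LengthFunction 𝓔}

theorem not_isZero_of_mem_thetaOne {X : C} (hX : X ∈ Θ.thetaOne) : ¬ IsZero X := by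
  intro h
  have := hX.1
  rw [(Θ.len_eq_zero X).2 h] at this
  exact this.false

theorem not_isZero_iff_len_pos {X : C} : ¬ IsZero X ↔ 0 < Θ.len X := by
  rw [← Θ.len_eq_zero X]
  omega

theorem len_eq_of_mem_thetaOne {X Y : C} (hX : X ∈ Θ.thetaOne) (hY : Y ∈ Θ.thetaOne) :
    Θ.len X = Θ.len Y :=
  le_antisymm (hX.2 _ (not_isZero_of_mem_thetaOne hY)) (hY.2 _ (not_isZero_of_mem_thetaOne hX))

theorem thetaOne_of_iso {X Y : C} (hX : X ∈ Θ.thetaOne) (e : X ≅ Y) : Y ∈ Θ.thetaOne := by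
  have := Θ.len_iso e
  exact ⟨this ▸ hX.1, this ▸ hX.2⟩

namespace IsKrullSchmidtLength

variable [HasBinaryBiproducts C] [HasFiniteBiproducts C] (H : Θ.IsKrullSchmidtLength)
include H

theorem indecomposable_of_mem_thetaOne {X : C} (hX : X ∈ Θ.thetaOne) : Indecomposable X := by
  refine ⟨not_isZero_of_mem_thetaOne hX, fun Y Z e => ?_⟩
  by_contra! h
  have h1 := hX.2 Y h.1
  have h2 := (not_isZero_iff_len_pos (Θ := Θ)).1 h.2
  have h3 := Θ.len_iso e
  rw [H.len_biprod] at h3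
  omega

theorem isInflation_of_mem_thetaOne {X M : C} (hX : X ∈ Θ.thetaOne) {f : X ⟶ M} (hf : f ≠ 0) :
    Θ.IsInflation f := by
  obtain ⟨Z, d, j, hd, hj, rfl⟩ := H.admissible f
  have hZ : ¬ IsZero Z := fun h => hf (by rw [h.eq_of_tgt d 0, zero_comp])
  have := hd.isIso H.extri (hX.2 Z hZ)
  exact (Θ.isInflation_of_isIso H.extri d).comp H.extri hj

theorem isDeflation_of_mem_thetaOne {X M : C} (hX : X ∈ Θ.thetaOne) {f : M ⟶ X} (hf : f ≠ 0) :
    Θ.IsDeflation f := by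
  obtain ⟨Z, d, j, hd, hj, rfl⟩ := H.admissible f
  have hZ : ¬ IsZero Z := fun h => hf (by rw [h.eq_of_tgt d 0, zero_comp])
  have := hj.isIso H.extri (hX.2 Z hZ)
  exact hd.comp H.extri (Θ.isDeflation_of_isIso H.extri j)

variable (htheta : Θ.thetaOne = Θ.thetaInfty)
include htheta

/-- If `Θ₁ = Θ_∞`, then every nonzero object has a subobject or a quotient object in `Θ₁`. -/
theorem exists_thetaOne_sub_or_quotient {M : C} (hM : ¬ IsZero M) :
    ∃ X ∈ Θ.thetaOne, (∃ f : X ⟶ M, Θ.IsInflation f) ∨ ∃ f : M ⟶ X, Θ.IsDeflation f := by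
  by_cases h1 : M ∈ Θ.thetaOne
  · exact ⟨M, h1, Or.inl ⟨𝟙 M, Θ.isInflation_of_isIso H.extri _⟩⟩
  have hpos := (not_isZero_iff_len_pos (Θ := Θ)).1 hM
  obtain ⟨n, hn⟩ : ∃ n, Θ.len M = n + 2 := by
    refine ⟨Θ.len M - 2, ?_⟩
    have : Θ.len M ≠ 1 := fun h =>
      h1 ⟨hpos, fun N hN => h ▸ not_isZero_iff_len_pos.1 hN⟩
    omega
  have hsub : ∀ k, Θ.theta k ⊆ Θ.thetaOne := fun k => by
    rw [htheta]
    exact Set.subset_iUnion _ k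
  -- `theta n` is `Θ_{n+1}`, so an `M` of length `n + 2` orthogonal to it would enter at `Θ_{n+2}`.
  have hnot : ¬ ∀ X ∈ Θ.theta n, (∀ f : X ⟶ M, f = 0) ∧ (∀ f : M ⟶ X, f = 0) :=
    fun h => h1 (hsub (n + 1) (Or.inr ⟨h, hn⟩))
  push Not at hnot
  obtain ⟨X, hX, h⟩ := hnot
  have hX1 := hsub n hX
  by_cases h0 : ∀ f : X ⟶ M, f = 0
  · obtain ⟨f, hf⟩ := h h0
    exact ⟨X, hX1, Or.inr ⟨f, H.isDeflation_of_mem_thetaOne hX1 hf⟩⟩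
  · push Not at h0
    obtain ⟨f, hf⟩ := h0
    exact ⟨X, hX1, Or.inl ⟨f, H.isInflation_of_mem_thetaOne hX1 hf⟩⟩

/-- If only a quotient in `Θ₁` is available, pass to its kernel, which is shorter. -/
theorem exists_thetaOne_sub {M : C} (hM : ¬ IsZero M) :
    ∃ X ∈ Θ.thetaOne, ∃ f : X ⟶ M, Θ.IsInflation f := by
  induction hn : Θ.len M using Nat.strong_induction_on generalizing M with
  | _ n ih =>
  obtain ⟨X, hX, h | ⟨f, K, k, δ, hr, hl⟩⟩ := H.exists_thetaOne_sub_or_quotient htheta hM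
  · exact ⟨X, hX, h⟩
  · have hk : Θ.IsInflation k := ⟨X, f, δ, hr, hl⟩
    by_cases hK : IsZero K
    · have := H.extri.isIso_defl_of_isZero hr hK
      exact ⟨X, hX, inv f, Θ.isInflation_of_isIso H.extri _⟩
    · have := hX.1
      obtain ⟨Y, hY, g, hg⟩ := ih (Θ.len K) (by omega) hK rfl
      exact ⟨Y, hY, g ≫ k, hg.comp H.extri hk⟩

theorem exists_thetaOne_quotient {M : C} (hM : ¬ IsZero M) :
    ∃ X ∈ Θ.thetaOne, ∃ f : M ⟶ X, Θ.IsDeflation f := by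
  induction hn : Θ.len M using Nat.strong_induction_on generalizing M with
  | _ n ih =>
  obtain ⟨X, hX, ⟨f, K, k, δ, hr, hl⟩ | h⟩ := H.exists_thetaOne_sub_or_quotient htheta hM
  · have hk : Θ.IsDeflation k := ⟨X, f, δ, hr, hl⟩
    by_cases hK : IsZero K
    · have := H.extri.isIso_inf_of_isZero hr hK
      exact ⟨X, hX, inv f, Θ.isDeflation_of_isIso H.extri _⟩
    · have := hX.1
      obtain ⟨Y, hY, g, hg⟩ := ih (Θ.len K) (by omega) hK rfl
      exact ⟨Y, hY, k ≫ g, hk.comp H.extri hg⟩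
  · exact ⟨X, hX, h⟩

end IsKrullSchmidtLength

end LengthFunction

end SimpleObjects

/-! ### Linear dependence in modules of finite length. -/

section Bound

/-- If no vector lay in the span of its predecessors, the initial spans would form a strict chain
with `n` steps. -/
theorem exists_mem_span_of_length_lt {R M : Type*} [Ring R] [AddCommGroup M] [Module R M] {n : ℕ}
    (h : Module.length R M < n) (v : Fin n → M) :
    ∃ (i : Fin n) (c : Fin n → R), c i = 0 ∧ v i = ∑ j, c j • v j := by
  by_contra! hv
  have hlt : ∀ i : Fin n, v i ∉ Submodule.span R (v '' {j | j < i}) := by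
    intro i hi
    obtain ⟨t, hc, c, hsum⟩ := (Submodule.mem_span_image_iff_exists_fun R).1 hi
    refine hv i (fun j => if h : j ∈ t then c ⟨j, h⟩ else 0) (dif_neg fun hit => ?_) ?_
    · exact lt_irrefl i (hc hit)
    · rw [← hsum, ← Finset.sum_subset (Finset.subset_univ t)
        (fun j _ hj => by rw [dif_neg hj, zero_smul]), ← Finset.sum_coe_sort t]
      exact Finset.sum_congr rfl fun j _ => by rw [dif_pos j.2]
  have hmono : ∀ i : Fin n, Submodule.span R (v '' {j | j.1 < i.1}) <
      Submodule.span R (v '' {j | j.1 < i.1 + 1}) := by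
    intro i
    refine lt_of_le_of_ne (Submodule.span_mono (Set.image_mono fun j hj => ?_)) fun heq => ?_
    · exact Nat.lt_succ_of_lt hj
    · refine hlt i ?_
      have : v i ∈ Submodule.span R (v '' {j | j.1 < i.1 + 1}) :=
        Submodule.subset_span ⟨i, Nat.lt_succ_self _, rfl⟩
      rwa [← heq] at this
  let p : LTSeries (Submodule R M) :=
    { length := n
      toFun := fun k => Submodule.span R (v '' {j | j.1 < k.1})
      step := fun i => hmono i }
  have hp := Order.LTSeries.length_le_krullDim p
  rw [← Module.coe_length] at hp
  have : (n : ℕ∞) ≤ Module.length R M := by exact_mod_cast hp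
  exact absurd h (not_lt.2 this)

end Bound

/-! ### Classes of objects given by their summands; approximations. -/

section Summands

variable {C : Type u} [Category.{v} C] [Preadditive C] [HasBinaryBiproducts C]

/-- All indecomposable direct summands of `X` belong to `S`. -/
def SummandsIn (S : Set (IndClass C)) (X : C) : Prop :=
  ∀ ⦃Y : C⦄ (hY : Indecomposable Y) (i : Y ⟶ X) (r : X ⟶ Y), i ≫ r = 𝟙 Y → indClass hY ∈ S

theorem SummandsIn.of_isZero {S : Set (IndClass C)} {X : C} (hX : IsZero X) : SummandsIn S X := by
  intro Y hY i r h
  refine absurd ((IsZero.iff_id_eq_zero Y).2 ?_) hY.1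
  rw [← h, hX.eq_of_tgt i 0, zero_comp]

namespace LengthFunction.IsKrullSchmidtLength

variable [HasFiniteBiproducts C] {𝓔 : ExtriangulatedData.{w} C} {Θ : LengthFunction 𝓔}
  (H : Θ.IsKrullSchmidtLength) {S : Set (IndClass C)}
include H

theorem summandsIn_biprod {X Y : C} (hX : SummandsIn S X) (hY : SummandsIn S Y) :
    SummandsIn S (X ⊞ Y) := by
  intro Z hZ i r h
  have := H.isLocalRing_end hZ
  rcases isIso_or_isIso_of_biprod h with h | h
  · exact hX hZ (i ≫ biprod.fst) (biprod.inl ≫ r ≫ inv ((i ≫ biprod.fst) ≫ biprod.inl ≫ r))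
      (by have := IsIso.hom_inv_id ((i ≫ biprod.fst) ≫ biprod.inl ≫ r)
          simpa only [Category.assoc] using this)
  · exact hY hZ (i ≫ biprod.snd) (biprod.inr ≫ r ≫ inv ((i ≫ biprod.snd) ≫ biprod.inr ≫ r))
      (by have := IsIso.hom_inv_id ((i ≫ biprod.snd) ≫ biprod.inr ≫ r)
          simpa only [Category.assoc] using this)

theorem summandsIn_of_mem {X : C} (hX : Indecomposable X) (hXS : indClass hX ∈ S) :
    SummandsIn S X := by
  intro Y hY i r h
  have := H.isIso_of_retract_of_indecomposable hX hY.1 h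
  rwa [indClass_eq_iff.2 ⟨asIso i⟩]

theorem indClass_eq_of_retract {X Y : C} (hX : Indecomposable X) (hY : Indecomposable Y)
    {i : Y ⟶ X} {r : X ⟶ Y} (h : i ≫ r = 𝟙 Y) : indClass hY = indClass hX :=
  H.summandsIn_of_mem (S := {indClass hX}) hX rfl hY i r h

/-- The subobjects of an object whose summands have measure smaller than `κ` have the same
property. -/
theorem summandsIn_of_isInflation {κ : Colex (Finset ℕᵒᵈ)} {X Y : C} {f : X ⟶ Y}
    (hf : Θ.IsInflation f) (hY : SummandsIn {c | Θ.grKey c < κ} Y) :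
    SummandsIn {c | Θ.grKey c < κ} X := by
  intro Z hZ i r h
  rcases H.exists_retraction_or_grKey_lt hZ ((H.isInflation_of_retract h).comp H.extri hf) with
    ⟨s, hs⟩ | ⟨Y', hY', i', r', h', hlt⟩
  · exact hY hZ _ s hs
  · exact hlt.trans (hY hY' i' r' h')

/-- Every object `M` has a left approximation by objects whose summands have measure smaller than
`κ`, and the approximation is a deflation. -/
theorem exists_left_approximation (κ : Colex (Finset ℕᵒᵈ)) (M : C) :
    ∃ (L : C) (q : M ⟶ L), Θ.IsDeflation q ∧ SummandsIn {c | Θ.grKey c < κ} L ∧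
      ∀ (Z : C), SummandsIn {c | Θ.grKey c < κ} Z → ∀ g : M ⟶ Z, ∃ s : L ⟶ Z, q ≫ s = g := by
  -- The least `n` selects a quotient `L` of maximal length in the class. The image of `(q, g)` in
  -- `L ⊞ Z` lies in the class too and maps onto `L`, so it is `L`.
  let P : ℕ → Prop := fun n => ∃ (L : C) (q : M ⟶ L), Θ.IsDeflation q ∧
    SummandsIn {c | Θ.grKey c < κ} L ∧ Θ.len M = Θ.len L + n
  have hP : ∃ n, P n := by
    obtain ⟨Z, hZ⟩ := HasZeroObject.zero (C := C)
    refine ⟨Θ.len M, Z, 0, ⟨M, 𝟙 M, 0, H.extri.realizes_id_zero M hZ, ?_⟩, .of_isZero hZ, ?_⟩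
    all_goals simp [(Θ.len_eq_zero Z).2 hZ]
  classical
  obtain ⟨L, q, hq, hL, hl⟩ := Nat.find_spec hP
  refine ⟨L, q, hq, hL, fun Z hZ g => ?_⟩
  obtain ⟨W, d, j, hd, hj, hdj⟩ := H.admissible (biprod.lift q g)
  have hq' : d ≫ j ≫ biprod.fst = q := by rw [reassoc_of% hdj, biprod.lift_fst]
  have hg' : d ≫ j ≫ biprod.snd = g := by rw [reassoc_of% hdj, biprod.lift_snd]
  have hW := H.summandsIn_of_isInflation hj (H.summandsIn_biprod hL hZ)
  have hdefl : Θ.IsDeflation (j ≫ biprod.fst : W ⟶ L) :=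
    H.isDeflation_of_comp (f := d) (by rwa [hq'])
  have hWM := hd.len_le
  have hmin := Nat.find_min' hP (m := Θ.len M - Θ.len W) ⟨W, d, hd, hW, by omega⟩
  have := hdefl.isIso H.extri (by omega)
  refine ⟨inv (j ≫ biprod.fst) ≫ j ≫ biprod.snd, ?_⟩
  rw [← hq', Category.assoc, IsIso.hom_inv_id_assoc, hg']

/-- Endomorphisms which factor through indecomposables not occurring in `L` are in the radical. -/
theorem exists_right_inverse_of_factors {L : C} (hL : SummandsIn S L) {J : Type*} (t : Finset J)
    {M : J → C} (hM : ∀ j, Indecomposable (M j)) (hMS : ∀ j, indClass (hM j) ∉ S)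
    (s : ∀ j, L ⟶ M j) (q : ∀ j, M j ⟶ L) :
    ∃ z : L ⟶ L, (𝟙 L + ∑ j ∈ t, s j ≫ q j) ≫ z = 𝟙 L := by
  obtain ⟨n, Y, hY, ⟨e⟩⟩ := H.krullSchmidt L
  have key : ∀ j k, (End.of (s j ≫ q j ≫ e.hom ≫ biproduct.π Y k ≫ biproduct.ι Y k ≫
      e.inv)) ∈ Ideal.jacobson (⊥ : Ideal (End L)) := by
    intro j k
    rw [Ideal.mem_jacobson_iff]
    intro y
    have := hY k
    let a : L ⟶ Y k := s j ≫ q j ≫ e.hom ≫ biproduct.π Y k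
    let b : Y k ⟶ L := biproduct.ι Y k ≫ e.inv ≫ (y : L ⟶ L)
    -- If `b ≫ a` were invertible, `Y k` would be a retract of `M j`, hence isomorphic to it, making
    -- `M j` a summand of `L`.
    have hsum : -(b ≫ a) + (𝟙 _ + b ≫ a) = 𝟙 (Y k) := by abel
    have hiso : IsIso (𝟙 (Y k) + b ≫ a) := by
      refine (isIso_or_isIso_of_add_eq_id hsum).resolve_left fun hneg => ?_
      have hYk := indecomposable_of_isLocalRing (Y k)
      have h1 : (b ≫ s j) ≫ ((q j ≫ e.hom ≫ biproduct.π Y k) ≫ (-inv (-(b ≫ a)))) = 𝟙 (Y k) := by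
        have := IsIso.hom_inv_id (-(b ≫ a))
        rw [Preadditive.neg_comp, ← Preadditive.comp_neg] at this
        simpa [a] using this
      refine hMS j ?_
      rw [← H.indClass_eq_of_retract (hM j) hYk h1]
      exact hL hYk (biproduct.ι Y k ≫ e.inv) (e.hom ≫ biproduct.π Y k) (by simp)
    obtain ⟨v, hv⟩ : ∃ v, v + b ≫ a ≫ v = 𝟙 (Y k) := by
      refine ⟨inv (𝟙 (Y k) + b ≫ a), ?_⟩
      have := IsIso.hom_inv_id (𝟙 (Y k) + b ≫ a)
      simpa only [Preadditive.add_comp, Category.id_comp, Category.assoc] using this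
    -- The usual passage from an inverse `v` of `1 + ba` to one of `1 + ab`. Multiplication in `End
    -- L` reverses `≫`, so left inverses there are right inverses for `≫`.
    refine ⟨End.of (𝟙 L - a ≫ v ≫ b), ?_⟩
    have hyx : y * End.of (s j ≫ q j ≫ e.hom ≫ biproduct.π Y k ≫ biproduct.ι Y k ≫ e.inv) =
        End.of (a ≫ b) := by
      simp [End.mul_def, a, b, End.of]
    rw [Ideal.mem_bot, mul_assoc, hyx]
    change (a ≫ b) ≫ (𝟙 L - a ≫ v ≫ b) + (𝟙 L - a ≫ v ≫ b) - 𝟙 L = 0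
    have hb : v ≫ b + b ≫ a ≫ v ≫ b = b := by
      have := congrArg (· ≫ b) hv
      simpa only [Preadditive.add_comp, Category.assoc, Category.id_comp] using this
    have hab := congrArg (a ≫ ·) hb
    simp only [Preadditive.comp_add] at hab
    simp only [Preadditive.comp_sub, Category.comp_id, Category.assoc]
    rw [← hab]
    abel
  have hj : ∀ j, (End.of (s j ≫ q j)) ∈ Ideal.jacobson (⊥ : Ideal (End L)) := by
    intro j
    have h1 : s j ≫ q j = ∑ k, s j ≫ q j ≫ e.hom ≫ biproduct.π Y k ≫ biproduct.ι Y k ≫ e.inv := by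
      have : ∑ k, (s j ≫ q j ≫ e.hom) ≫ (biproduct.π Y k ≫ biproduct.ι Y k) ≫ e.inv = s j ≫ q j := by
        rw [← Preadditive.comp_sum, ← Preadditive.sum_comp, biproduct.total]
        simp
      rw [← this]
      simp
    rw [h1]
    exact Ideal.sum_mem _ fun k _ => key j k
  have hx : (End.of (∑ j ∈ t, s j ≫ q j)) ∈ Ideal.jacobson (⊥ : Ideal (End L)) :=
    Ideal.sum_mem _ fun j _ => hj j
  obtain ⟨z, hz⟩ := Ideal.mem_jacobson_iff.1 hx 1
  let z' : L ⟶ L := z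
  refine ⟨z', ?_⟩
  rw [Ideal.mem_bot, mul_one] at hz
  have hz' : (∑ j ∈ t, s j ≫ q j) ≫ z' + z' - 𝟙 L = 0 := hz
  rw [Preadditive.add_comp, Category.id_comp, add_comm]
  exact sub_eq_zero.1 hz'

end LengthFunction.IsKrullSchmidtLength

end Summands

/-! ### Bounding extensions by the length of `𝔼`. -/

section ExtensionBound

variable {C : Type u} [Category.{v} C] [Preadditive C] [HasBinaryBiproducts C]
  {R : Type*} [CommRing R] [Linear R C] {𝓔 : ExtriangulatedData.{w} C} [𝓔.RLinear R]

/-- If the sub-object of an extension contains a summand more often than the length of the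
extension group permits, then this summand splits off the extension. -/
theorem IsExtriangulated.exists_retract_of_length_lt (h𝓔 : IsExtriangulated 𝓔) {A B D Y : C}
    {x : A ⟶ B} {y : B ⟶ D} {δ : 𝓔.Ext D A} (h : 𝓔.Realizes x y δ) {n : ℕ}
    (sec : Fin n → (Y ⟶ A)) (pr : Fin n → (A ⟶ Y)) (hself : ∀ i, sec i ≫ pr i = 𝟙 Y)
    (hne : ∀ i j, i ≠ j → sec i ≫ pr j = 0) (hn : Module.length R (𝓔.Ext D Y) < n) :
    ∃ (i : Y ⟶ B) (r : B ⟶ Y), i ≫ r = 𝟙 Y := by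
  obtain ⟨i, c, hci, hc⟩ := exists_mem_span_of_length_lt (R := R) hn fun j => 𝓔.push (pr j) δ
  -- This combination kills `δ`, so it extends along `x`. As `c i = 0`, it still restricts to the
  -- identity along `sec i`.
  obtain ⟨g, hg⟩ := h𝓔.exists_ext_of_push_eq_zero h (pr i + -∑ j, c j • pr j) (by
    rw [𝓔.push_add, 𝓔.push_neg, 𝓔.push_sum]
    simp only [ExtriangulatedData.RLinear.smul_push]
    rw [← hc, add_neg_cancel])
  refine ⟨sec i ≫ x, g, ?_⟩
  have h0 : ∑ j, sec i ≫ (c j • pr j) = 0 := by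
    refine Finset.sum_eq_zero fun j _ => ?_
    rw [Linear.comp_smul]
    by_cases hij : i = j
    · rw [← hij, hci, zero_smul]
    · rw [hne i j hij, smul_zero]
  rw [Category.assoc, hg, Preadditive.comp_add, Preadditive.comp_neg, Preadditive.comp_sum, h0,
    neg_zero, add_zero, hself]

variable [HasFiniteBiproducts C] {Θ : LengthFunction 𝓔}

namespace LengthFunction.IsKrullSchmidtLength

variable (H : Θ.IsKrullSchmidtLength)
include H

/-- Every object is a biproduct of representatives of the isomorphism classes of its
indecomposable summands. -/
theorem exists_iso_biproduct_out {S : Set (IndClass C)} {X : C} (hX : SummandsIn S X) :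
    ∃ (m : ℕ) (c : Fin m → S), m ≤ Θ.len X ∧ Nonempty (X ≅ ⨁ fun k => (c k).1.1.out) := by
  obtain ⟨m, Y, hY, ⟨e⟩⟩ := H.krullSchmidt X
  have hind : ∀ k, Indecomposable (Y k) := fun k =>
    have := hY k
    indecomposable_of_isLocalRing (Y k)
  have hiso : ∀ k, Nonempty (Y k ≅ (indClass (hind k)).1.out) := fun k =>
    isoClass_eq_iff.1 (Quotient.out_eq (indClass (hind k)).1).symm
  refine ⟨m, fun k => ⟨indClass (hind k), hX (hind k) (biproduct.ι Y k ≫ e.inv)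
    (e.hom ≫ biproduct.π Y k) (by simp)⟩, ?_, ⟨e ≪≫ biproduct.mapIso fun k => (hiso k).some⟩⟩
  rw [Θ.len_iso e, H.len_biproduct]
  calc m = ∑ k : Fin m, 1 := by simp
    _ ≤ ∑ k, Θ.len (Y k) := Finset.sum_le_sum fun k _ => not_isZero_iff_len_pos.1 (hind k).1

theorem indecomposable_out (c : IndClass C) : Indecomposable c.1.out := by
  obtain ⟨X, hX, rfl⟩ := exists_eq_indClass c
  have := H.isLocalRing_end hX
  obtain ⟨e⟩ : Nonempty (X ≅ (indClass hX).1.out) :=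
    isoClass_eq_iff.1 (Quotient.out_eq (indClass hX).1).symm
  have := isLocalRing_end_of_iso e
  exact indecomposable_of_isLocalRing _

theorem indClass_out (c : IndClass C) : indClass (H.indecomposable_out c) = c :=
  Subtype.ext (Quotient.out_eq c.1)

/-- Every summand has positive length, so there are at most `n` of them. -/
theorem finite_isoClass_summandsIn {S : Set (IndClass C)} (hS : S.Finite) (n : ℕ) :
    {t : IsoClass C | ∃ L, isoClass L = t ∧ SummandsIn S L ∧ Θ.len L ≤ n}.Finite := by
  have := hS.to_subtype
  refine (Set.finite_range fun a : (Σ m : Fin (n + 1), (Fin m.1 → S)) =>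
    isoClass (⨁ fun k => (a.2 k).1.1.out)).subset ?_
  rintro _ ⟨L, rfl, hL, hl⟩
  obtain ⟨m, c, hm, ⟨e⟩⟩ := H.exists_iso_biproduct_out hL
  exact ⟨⟨⟨m, by omega⟩, c⟩, (isoClass_eq_of_iso e).symm⟩

/-- The length of the first term of an extension of a fixed object `D` is bounded, if its summands
belong to a fixed finite set and none of them splits off the extension. -/
theorem exists_len_bound (hfin : 𝓔.RFinite R) {S : Set (IndClass C)} (hS : S.Finite) (D : C) :
    ∃ N : ℕ, ∀ {A B : C} {x : A ⟶ B} {y : B ⟶ D} {δ : 𝓔.Ext D A}, 𝓔.Realizes x y δ →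
      SummandsIn S A → (∀ (Y : C) (hY : Indecomposable Y) (i : Y ⟶ B) (r : B ⟶ Y),
        i ≫ r = 𝟙 Y → indClass hY ∉ S) → Θ.len A ≤ N := by
  classical
  have := hS.fintype
  let l : S → ℕ := fun c => (Module.length R (𝓔.Ext D c.1.1.out)).toNat
  let b : ℕ := Finset.univ.sup fun c : S => Θ.len c.1.1.out
  refine ⟨(∑ c, l c) * b, fun {A B x y δ} hr hA hB => ?_⟩
  obtain ⟨m, c, -, ⟨e⟩⟩ := H.exists_iso_biproduct_out hA
  have hfiber : ∀ a : S, (Finset.univ.filter fun k => c k = a).card ≤ l a := by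
    intro a
    by_contra! hlt
    let g := (Finset.univ.filter fun k => c k = a).orderEmbOfCardLe (Nat.succ_le_of_lt hlt)
    have hg : ∀ i, c (g i) = a := fun i =>
      (Finset.mem_filter.1 (Finset.orderEmbOfCardLe_mem _ (Nat.succ_le_of_lt hlt) i)).2
    have hobj : ∀ i, (c (g i)).1.1.out = a.1.1.out := fun i => by rw [hg i]
    obtain ⟨i, r, hir⟩ := H.extri.exists_retract_of_length_lt (R := R) hr (Y := a.1.1.out)
      (fun i => eqToHom (hobj i).symm ≫ biproduct.ι (fun k => (c k).1.1.out) (g i) ≫ e.inv)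
      (fun i => e.hom ≫ biproduct.π (fun k => (c k).1.1.out) (g i) ≫ eqToHom (hobj i))
      (fun i => by simp)
      (fun i j hij => by
        simp [biproduct.ι_π_ne_assoc (fun k => (c k).1.1.out) (fun h => hij (g.injective h))])
      (by
        rw [← ENat.natCast_toNat (hfin D a.1.1.out).2.ne]
        exact_mod_cast Nat.lt_succ_self _)
    refine hB _ (H.indecomposable_out a.1) i r hir ?_
    rw [H.indClass_out]
    exact a.2
  have hm : m ≤ ∑ a, l a := by
    calc m = (Finset.univ : Finset (Fin m)).card := by simp
      _ = ∑ a, (Finset.univ.filter fun k => c k = a).card :=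
        Finset.card_eq_sum_card_fiberwise fun k _ => Finset.mem_univ (c k)
      _ ≤ ∑ a, l a := Finset.sum_le_sum fun a _ => hfiber a
  rw [Θ.len_iso e, H.len_biproduct]
  calc ∑ k, Θ.len (c k).1.1.out ≤ ∑ _k : Fin m, b :=
        Finset.sum_le_sum fun k _ => Finset.le_sup (f := fun c : S => Θ.len c.1.1.out)
          (Finset.mem_univ (c k))
    _ = m * b := by simp
    _ ≤ _ := Nat.mul_le_mul_right b hm

end LengthFunction.IsKrullSchmidtLength

end ExtensionBound

/-! ### The two finiteness results. -/

section FiniteType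

variable {C : Type u} [Category.{v} C] [Preadditive C] [HasBinaryBiproducts C]
  {𝓔 : ExtriangulatedData.{w} C} {Θ : LengthFunction 𝓔}

theorem LengthFunction.grMeasure_of_mem_thetaOne {T : C} (hT : T ∈ Θ.thetaOne) (hT' : Indecomposable T) :
    Θ.grMeasure (indClass hT') = {Θ.len T} := by
  refine Finset.eq_singleton_iff_unique_mem.2 ⟨Θ.isoLen_mem_grMeasure (indClass hT'), ?_⟩
  intro n hn
  refine le_antisymm (Θ.le_isoLen_of_mem_grMeasure hn) ?_
  obtain ⟨s, hs, h⟩ := Θ.exists_chain_grMeasure (indClass hT')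
  rw [← h] at hn
  obtain ⟨d, -, rfl⟩ := Finset.mem_image.1 hn
  obtain ⟨X, hX, rfl⟩ := exists_eq_indClass d
  exact hT.2 X hX.1

theorem LengthFunction.grKey_eq_of_mem_thetaOne {T T' : C} (hT : T ∈ Θ.thetaOne) (hT' : T' ∈ Θ.thetaOne)
    (hi : Indecomposable T) (hi' : Indecomposable T') :
    Θ.grKey (indClass hi) = Θ.grKey (indClass hi') := by
  rw [grKey, grKey, grMeasure_of_mem_thetaOne hT, grMeasure_of_mem_thetaOne hT',
    len_eq_of_mem_thetaOne hT hT']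

variable [HasFiniteBiproducts C] {R : Type*} [CommRing R] [Linear R C] [𝓔.RLinear R]

namespace LengthFunction.IsKrullSchmidtLength

variable (H : Θ.IsKrullSchmidtLength)
include H

/-- Outside of a finite set which is closed under smaller measures, the measures are bounded below
by measures of objects of bounded length. -/
theorem exists_isoLen_bound (hfin : 𝓔.RFinite R) (htheta : Θ.thetaOne = Θ.thetaInfty)
    (hone : (isoClass '' Θ.thetaOne).Finite) {S : Set (IndClass C)} (hS : S.Finite) :
    ∃ N : ℕ, ∀ c, c ∉ S → ∃ d, d ∉ S ∧ Θ.grKey d ≤ Θ.grKey c ∧ Θ.isoLen d.1 ≤ N := by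
  classical
  choose N hN using H.exists_len_bound hfin hS
  refine ⟨hone.toFinset.sup fun t => N t.out + Θ.len t.out, fun c hc => ?_⟩
  have hex : ∃ n, ∃ d : IndClass C, d ∉ S ∧ Θ.Sub d.1 c.1 ∧ Θ.isoLen d.1 = n := by
    obtain ⟨X, hX, rfl⟩ := exists_eq_indClass c
    exact ⟨_, _, hc, ⟨X, X, 𝟙 X, rfl, rfl, Θ.isInflation_of_isIso H.extri _⟩, rfl⟩
  obtain ⟨d, hdS, hdc, hd⟩ := Nat.find_spec hex
  refine ⟨d, hdS, grKey_le_of_sub H.extri hdc, ?_⟩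
  obtain ⟨M, hM, rfl⟩ := exists_eq_indClass d
  obtain ⟨T, hT, f, hf⟩ := H.exists_thetaOne_quotient htheta hM.1
  obtain ⟨e⟩ : Nonempty (T ≅ (isoClass T).out) := isoClass_eq_iff.1 (Quotient.out_eq _).symm
  obtain ⟨K, k, δ, hr, hl⟩ := hf.comp H.extri (Θ.isDeflation_of_isIso H.extri e.hom)
  have hk : Θ.IsInflation k := ⟨_, _, δ, hr, hl⟩
  have hTpos : 0 < Θ.len (isoClass T).out := Θ.len_iso e ▸ hT.1
  -- A summand of `K` outside `S` would be a subobject of `c` shorter than `M`.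
  have hK : SummandsIn S K := by
    intro X hX i r hir
    by_contra hXS
    have hi := H.isInflation_of_retract hir
    have hle := hi.len_le
    have hsub : Θ.Sub (isoClass X) c.1 :=
      Sub.trans H.extri ⟨X, M, i ≫ k, rfl, rfl, hi.comp H.extri hk⟩ hdc
    have hmin := Nat.find_min' hex ⟨indClass hX, hXS, hsub, rfl⟩
    rw [← hd] at hmin
    change Θ.len M ≤ Θ.len X at hmin
    omega
  have hNK := hN _ hr hK fun Y hY i r hir hYS =>
    hdS (by rwa [← H.indClass_eq_of_retract hM hY hir])
  refine le_trans ?_ (Finset.le_sup (f := fun t : IsoClass C => N t.out + Θ.len t.out)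
    (hone.mem_toFinset.2 ⟨T, hT, rfl⟩))
  change Θ.len M ≤ _
  omega

/-- There is no infinite family of pairwise non-isomorphic indecomposables of measure `κ` with a
common nonzero approximation by objects of measure smaller than `κ`, if there are only finitely
many indecomposables of the latter kind. -/
theorem not_exists_common_approximation (hfin : 𝓔.RFinite R) {κ : Colex (Finset ℕᵒᵈ)}
    (hκ : {c | Θ.grKey c < κ}.Finite) {L : C} (hL : SummandsIn {c | Θ.grKey c < κ} L)
    {M : ℕ → C} (hM : ∀ j, Indecomposable (M j)) (hMκ : ∀ j, Θ.grKey (indClass (hM j)) = κ)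
    (hMM : ∀ j k, j ≠ k → ¬ Nonempty (M j ≅ M k)) {q : ∀ j, M j ⟶ L}
    (hq : ∀ j, Θ.IsDeflation (q j)) (hq0 : ∀ j, q j ≠ 0)
    (hqL : ∀ j (Z : C), SummandsIn {c | Θ.grKey c < κ} Z → ∀ g : M j ⟶ Z, ∃ s, q j ≫ s = g) :
    False := by
  have hlen : ∀ j k, Θ.len (M j) = Θ.len (M k) := fun j k =>
    Θ.isoLen_eq_of_grKey_eq ((hMκ j).trans (hMκ k).symm)
  obtain ⟨N, hN⟩ := H.exists_len_bound hfin hκ L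
  -- With this many nonzero summands, the kernel of the map to `L` has length greater than `N`.
  let F : Fin (N + Θ.len L + 1) → C := fun j => M j
  let p : ⨁ F ⟶ L := biproduct.desc fun j => q j
  have hp : Θ.IsDeflation p := by
    refine H.isDeflation_of_comp (f := biproduct.ι F 0) ?_
    rw [biproduct.ι_desc]
    exact hq _
  have hretract : ∀ (Y : C) (hY : Indecomposable Y) (i : Y ⟶ ⨁ F) (r : ⨁ F ⟶ Y),
      i ≫ r = 𝟙 Y → ∃ k, IsIso (i ≫ biproduct.π F k) := by
    intro Y hY i r hir
    have := H.isLocalRing_end hY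
    obtain ⟨k, hk⟩ := exists_isIso_of_biproduct hir
    refine ⟨k, H.isIso_of_retract_of_indecomposable (hM k) hY.1 (r := (biproduct.ι F k ≫ r) ≫
      inv ((i ≫ biproduct.π F k) ≫ biproduct.ι F k ≫ r)) ?_⟩
    rw [← Category.assoc, IsIso.hom_inv_id]
  have hmeasure : ∀ (Y : C) (hY : Indecomposable Y) (i : Y ⟶ ⨁ F) (r : ⨁ F ⟶ Y),
      i ≫ r = 𝟙 Y → Θ.grKey (indClass hY) = κ := by
    intro Y hY i r hir
    obtain ⟨k, hk⟩ := hretract Y hY i r hir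
    rw [← hMκ k, indClass_eq_iff.2 ⟨asIso (i ≫ biproduct.π F k)⟩]
  obtain ⟨K, x, δ, hr, hl⟩ := hp
  have hx : Θ.IsInflation x := ⟨_, _, δ, hr, hl⟩
  have hlenF : N + Θ.len L + 1 ≤ Θ.len (⨁ F) := by
    rw [H.len_biproduct]
    calc N + Θ.len L + 1 = ∑ j : Fin (N + Θ.len L + 1), 1 := by simp
      _ ≤ _ := Finset.sum_le_sum fun j _ => not_isZero_iff_len_pos.1 (hM j).1
  have hK : ¬ SummandsIn {c | Θ.grKey c < κ} K := fun hK => by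
    have := hN hr hK fun Y hY i r hir => (hmeasure Y hY i r hir).not_lt
    omega
  simp only [SummandsIn, not_forall] at hK
  obtain ⟨Y, hY, i, s, his, hYκ⟩ := hK
  rcases H.exists_retraction_or_grKey_lt hY ((H.isInflation_of_retract his).comp H.extri hx) with
    ⟨r, hr'⟩ | ⟨Y', hY', i', r', h', hlt⟩
  swap
  · exact hYκ (hlt.trans_eq (hmeasure Y' hY' i' r' h'))
  obtain ⟨k, hk⟩ := hretract Y hY _ r hr'
  -- The split copy of `M k` in the kernel, normalized so that its `k`-th component is the identity.
  let h : ∀ j, M k ⟶ F j := fun j => inv ((i ≫ x) ≫ biproduct.π F k) ≫ (i ≫ x) ≫ biproduct.π F j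
  have hkk : h k = 𝟙 (M k) := IsIso.inv_hom_id _
  have hsum : ∑ j, h j ≫ q j = 0 := by
    have h1 : ∑ j, biproduct.π F j ≫ q j = p := by
      refine biproduct.hom_ext' _ _ fun j => ?_
      rw [biproduct.ι_desc, Preadditive.comp_sum, Finset.sum_eq_single j]
      · simp
      · intro l _ hlj
        rw [biproduct.ι_π_ne_assoc F hlj.symm, zero_comp]
      · simp
    have h2 : inv ((i ≫ x) ≫ biproduct.π F k) ≫ i ≫ x ≫ ∑ j, biproduct.π F j ≫ q j = 0 := by
      rw [h1, H.extri.comp_eq_zero hr, comp_zero, comp_zero]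
    simpa only [Preadditive.comp_sum, Category.assoc, h] using h2
  -- For `j ≠ k` the map `h j` is not invertible between objects of equal length. Its image is a
  -- proper subobject of `M j`, so has summands below `κ`, and `h j` factors through `q k`.
  have hfac : ∀ j, j ≠ k → ∃ s : L ⟶ F j, q k ≫ s = h j := by
    intro j hjk
    obtain ⟨Z, d, g, hd, hg, hdg⟩ := H.admissible (h j)
    have hlt : Θ.len Z < Θ.len (F j) := by
      by_contra! hge
      have := hg.isIso H.extri hge
      have h1 := Θ.len_iso (asIso g)
      have := hd.isIso H.extri (by rw [h1]; exact (hlen _ _).le)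
      exact hMM k j (fun e => hjk (Fin.ext e.symm)) ⟨asIso d ≪≫ asIso g⟩
    have hZ : SummandsIn {c | Θ.grKey c < κ} Z := fun W hW a b hab => by
      have ha := H.isInflation_of_retract hab
      have := H.grKey_lt hW (hM j) (ha.comp H.extri hg) (ha.len_le.trans_lt hlt)
      rwa [hMκ] at this
    obtain ⟨s, hs⟩ := hqL k Z hZ d
    exact ⟨s ≫ g, by rw [reassoc_of% hs, hdg]⟩
  choose! s hs using hfac
  obtain ⟨z, hz⟩ := H.exists_right_inverse_of_factors hL (Finset.univ.erase k)
    (M := F) (fun j => hM j) (fun j hj => (hMκ j).not_lt hj) s (fun j => q j)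
  refine hq0 k ?_
  have hzero : q k ≫ (𝟙 L + ∑ j ∈ Finset.univ.erase k, s j ≫ q j) = 0 := by
    rw [← Finset.add_sum_erase _ _ (Finset.mem_univ k), hkk, Category.id_comp] at hsum
    rw [Preadditive.comp_add, Category.comp_id, Preadditive.comp_sum, ← hsum]
    congr 1
    refine Finset.sum_congr rfl fun j hj => ?_
    rw [← hs j (Finset.ne_of_mem_erase hj), Category.assoc]
  rw [← Category.comp_id (q k), ← hz, ← Category.assoc, hzero, zero_comp]

/-- If there are only finitely many indecomposables with measure smaller than `κ`, then there are
only finitely many with measure `κ`. -/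
theorem finite_grKey_eq (hfin : 𝓔.RFinite R) (htheta : Θ.thetaOne = Θ.thetaInfty)
    (hone : (isoClass '' Θ.thetaOne).Finite) {κ : Colex (Finset ℕᵒᵈ)}
    (hκ : {c | Θ.grKey c < κ}.Finite) : {c | Θ.grKey c = κ}.Finite := by
  classical
  by_contra hinf
  have hone' : {c : IndClass C | c.1 ∈ isoClass '' Θ.thetaOne}.Finite :=
    hone.preimage Subtype.val_injective.injOn
  -- Away from `Θ₁`, a subobject in `Θ₁` is proper, so the common measure of the objects in `Θ₁` is
  -- below `κ`. Then a quotient in `Θ₁` forces the approximation to be nonzero.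
  have hinf' : ({c | Θ.grKey c = κ} \ {c : IndClass C | c.1 ∈ isoClass '' Θ.thetaOne}).Infinite :=
    Set.Infinite.sdiff hinf hone'
  set U := {c | Θ.grKey c = κ} \ {c : IndClass C | c.1 ∈ isoClass '' Θ.thetaOne} with hU
  have hquot : ∀ {M : C} (hM : Indecomposable M), indClass hM ∈ U → ∃ T : C, ¬ IsZero T ∧
      SummandsIn {c | Θ.grKey c < κ} T ∧ ∃ f : M ⟶ T, Θ.IsDeflation f := by
    intro M hM hMU
    obtain ⟨T, hT, f, hf⟩ := H.exists_thetaOne_sub htheta hM.1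
    obtain ⟨T', hT', f', hf'⟩ := H.exists_thetaOne_quotient htheta hM.1
    have hi := H.indecomposable_of_mem_thetaOne hT
    have hi' := H.indecomposable_of_mem_thetaOne hT'
    refine ⟨T', hi'.1, H.summandsIn_of_mem hi' ?_, f', hf'⟩
    rw [Set.mem_ofPred_eq, grKey_eq_of_mem_thetaOne hT' hT hi' hi, ← hMU.1]
    refine H.grKey_lt hi hM hf ?_
    by_contra! hge
    have := hf.isIso H.extri hge
    exact hMU.2 ⟨M, thetaOne_of_iso hT (asIso f), rfl⟩
  obtain ⟨c₀, hc₀⟩ := hinf'.nonempty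
  have hlen : ∀ {M : C} (hM : Indecomposable M), indClass hM ∈ U →
      Θ.len M = Θ.isoLen c₀.1 := fun hM hMU =>
    Θ.isoLen_eq_of_grKey_eq (c := indClass hM) (hMU.1.trans hc₀.1.symm)
  have happrox := fun c : U => H.exists_left_approximation κ c.1.1.out
  choose L q hq hL hLq using happrox
  have hout : ∀ c : U, indClass (H.indecomposable_out c.1) ∈ U := fun c => by
    rw [H.indClass_out]; exact c.2
  have hfinL := H.finite_isoClass_summandsIn hκ (Θ.isoLen c₀.1)
  have := hfinL.to_subtype
  have := hinf'.to_subtype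
  let g : U → {t : IsoClass C | ∃ L, isoClass L = t ∧
      SummandsIn {c | Θ.grKey c < κ} L ∧ Θ.len L ≤ Θ.isoLen c₀.1} := fun c =>
    ⟨isoClass (L c), L c, rfl, hL c, (hq c).len_le.trans (hlen _ (hout c)).le⟩
  obtain ⟨t, hfib⟩ := Finite.exists_infinite_fiber g
  let a := Infinite.natEmbedding (g ⁻¹' {t})
  have e : ∀ j, Nonempty (L (a j).1 ≅ L (a 0).1) := fun j =>
    isoClass_eq_iff.1 (congrArg Subtype.val ((a j).2.trans (a 0).2.symm))
  have hdefl : ∀ j, Θ.IsDeflation (q (a j).1 ≫ (e j).some.hom) := fun j =>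
    (hq _).comp H.extri (Θ.isDeflation_of_isIso H.extri _)
  have hfac : ∀ j (Z : C), SummandsIn {c | Θ.grKey c < κ} Z →
      ∀ f : (a j).1.1.1.out ⟶ Z, ∃ s, (q (a j).1 ≫ (e j).some.hom) ≫ s = f := fun j Z hZ f => by
    obtain ⟨s, hs⟩ := hLq (a j).1 Z hZ f
    exact ⟨(e j).some.inv ≫ s, by simp [hs]⟩
  refine H.not_exists_common_approximation hfin hκ (hL (a 0).1)
    (M := fun j => (a j).1.1.1.out) (fun j => H.indecomposable_out _) (fun j => (hout _).1)
    (fun j k hjk ⟨i⟩ => ?_) (q := fun j => q (a j).1 ≫ (e j).some.hom) hdefl (fun j h0 => ?_) hfac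
  · have h1 : indClass (H.indecomposable_out (a j).1.1) = indClass (H.indecomposable_out (a k).1.1) :=
      indClass_eq_iff.2 ⟨i⟩
    rw [H.indClass_out, H.indClass_out] at h1
    exact hjk (a.injective (Subtype.ext (Subtype.ext h1)))
  · obtain ⟨T, hT, hTκ, f, hf⟩ := hquot _ (hout (a j).1)
    obtain ⟨s, rfl⟩ := hfac j T hTκ f
    rw [h0, zero_comp] at hf
    exact hT (H.isZero_of_zero_isDeflation hf)

end LengthFunction.IsKrullSchmidtLength

end FiniteType

/-! ### The Gabriel–Roiter chain. -/

section Chain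

variable {C : Type u} [Category.{v} C] [Preadditive C] [HasBinaryBiproducts C]
  {𝓔 : ExtriangulatedData.{w} C} {Θ : LengthFunction 𝓔}

namespace LengthFunction

theorem isGRTerm_mem_range {n : ℕ} {I : Finset ℕ} (h : Θ.IsGRTerm n I) :
    I ∈ Set.range Θ.grMeasure := by
  cases n with
  | zero => exact h.1
  | succ n =>
    obtain ⟨J, -, hI⟩ := h
    exact hI.1.1

theorem isGRTerm_succ_iff {n : ℕ} {I : Finset ℕ} : Θ.IsGRTerm (n + 1) I ↔ ∃ J, Θ.IsGRTerm n J ∧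
    I ∈ Set.range Θ.grMeasure ∧ lexKey J < lexKey I ∧
      ∀ c, lexKey J < Θ.grKey c → lexKey I ≤ Θ.grKey c := by
  have hlt : ∀ J K : Finset ℕ, LexLE J K ∧ J ≠ K ↔ lexKey J < lexKey K := fun J K => by
    rw [lexLE_iff_lexKey, lt_iff_le_and_ne, lexKey_injective.ne_iff]
  constructor
  · rintro ⟨J, hJ, ⟨hI, hJI⟩, hmin⟩
    exact ⟨J, hJ, hI, (hlt J I).1 hJI, fun c hc =>
      (lexLE_iff_lexKey _ _).1 (hmin _ ⟨⟨c, rfl⟩, (hlt J _).2 hc⟩)⟩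
  · rintro ⟨J, hJ, hI, hJI, hmin⟩
    refine ⟨J, hJ, ⟨hI, (hlt J I).2 hJI⟩, ?_⟩
    rintro _ ⟨⟨c, rfl⟩, hc⟩
    exact (lexLE_iff_lexKey _ _).2 (hmin c ((hlt J _).1 hc))

theorem isGRTerm_zero_iff {I : Finset ℕ} : Θ.IsGRTerm 0 I ↔
    I ∈ Set.range Θ.grMeasure ∧ ∀ c, lexKey I ≤ Θ.grKey c := by
  refine and_congr_right fun _ => ?_
  rw [Set.forall_mem_range]
  exact forall_congr' fun c => lexLE_iff_lexKey _ _

/-- All measures lie in the power set of one finite interval, and each term has at least as many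
elements of it below as its index. -/
theorem grChainBounded_of_bddAbove
    (h : BddAbove {n : ℕ | ∃ M : C, Indecomposable M ∧ Θ.len M = n}) : Θ.GRChainBounded := by
  classical
  obtain ⟨b, hb⟩ := h
  let G : Finset (Finset ℕ) := (Finset.range (b + 1)).powerset
  have hG : ∀ I ∈ Set.range Θ.grMeasure, I ∈ G := by
    rintro _ ⟨c, rfl⟩
    obtain ⟨X, hX, rfl⟩ := exists_eq_indClass c
    refine Finset.mem_powerset.2 fun n hn => Finset.mem_range_succ_iff.2 ?_
    exact (Θ.le_isoLen_of_mem_grMeasure hn).trans (hb ⟨X, hX, rfl⟩)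
  have key : ∀ n I, Θ.IsGRTerm n I → n ≤ (G.filter fun K => lexKey K < lexKey I).card := by
    intro n
    induction n with
    | zero => exact fun _ _ => Nat.zero_le _
    | succ n ih =>
      intro I hI
      obtain ⟨J, hJ, -, hJI, -⟩ := isGRTerm_succ_iff.1 hI
      refine Nat.succ_le_of_lt ((ih J hJ).trans_lt (Finset.card_lt_card ?_))
      refine Finset.ssubset_iff_of_subset (fun K hK => ?_) |>.2 ⟨J, ?_, ?_⟩
      · obtain ⟨hKG, hKJ⟩ := Finset.mem_filter.1 hK
        exact Finset.mem_filter.2 ⟨hKG, hKJ.trans hJI⟩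
      · exact Finset.mem_filter.2 ⟨hG J (isGRTerm_mem_range hJ), hJI⟩
      · exact fun hJJ => (Finset.mem_filter.1 hJJ).2.false
  refine ⟨G.card, ?_⟩
  rintro n ⟨I, hI⟩
  exact (key n I hI).trans (Finset.card_filter_le _ _)

namespace IsKrullSchmidtLength

variable [HasFiniteBiproducts C] {R : Type*} [CommRing R] [Linear R C] [𝓔.RLinear R]
  (H : Θ.IsKrullSchmidtLength) (hfin : 𝓔.RFinite R) (htheta : Θ.thetaOne = Θ.thetaInfty)
  (hone : (isoClass '' Θ.thetaOne).Finite)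
include H hfin htheta hone

/-- By `exists_isoLen_bound` it suffices to minimize over objects of length at most `N`, which have
finitely many measures. -/
theorem exists_least_grKey [Infinite (IndClass C)] {S : Set (IndClass C)} (hS : S.Finite) :
    ∃ c ∉ S, ∀ d ∉ S, Θ.grKey c ≤ Θ.grKey d := by
  obtain ⟨N, hN⟩ := H.exists_isoLen_bound hfin htheta hone hS
  have hfinite : (Θ.grMeasure '' {d | d ∉ S ∧ Θ.isoLen d.1 ≤ N}).Finite := by
    refine (Finset.finite_toSet (Finset.range (N + 1)).powerset).subset ?_
    rintro _ ⟨d, ⟨-, hd⟩, rfl⟩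
    refine Finset.mem_coe.2 (Finset.mem_powerset.2 fun n hn => Finset.mem_range_succ_iff.2 ?_)
    exact (Θ.le_isoLen_of_mem_grMeasure hn).trans hd
  obtain ⟨c, hc⟩ := hS.exists_notMem
  obtain ⟨d, hdS, -, hd⟩ := hN c hc
  obtain ⟨_, ⟨a, ⟨haS, -⟩, rfl⟩, hmin⟩ :=
    Set.exists_min_image _ lexKey hfinite ⟨_, d, ⟨hdS, hd⟩, rfl⟩
  refine ⟨a, haS, fun b hb => ?_⟩
  obtain ⟨b', hb'S, hbb', hb'⟩ := hN b hb
  exact (hmin _ ⟨b', ⟨hb'S, hb'⟩, rfl⟩).trans hbb'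

/-- Anything strictly below a term is at most the preceding term, so `finite_grKey_eq` applies
inductively. -/
theorem finite_le_of_isGRTerm {n : ℕ} {I : Finset ℕ} (hI : Θ.IsGRTerm n I) :
    {c | Θ.grKey c ≤ lexKey I}.Finite := by
  have key : ∀ I : Finset ℕ, {c | Θ.grKey c < lexKey I}.Finite →
      {c | Θ.grKey c ≤ lexKey I}.Finite := fun I hI =>
    (hI.union (H.finite_grKey_eq hfin htheta hone hI)).subset fun c hc =>
      (le_iff_lt_or_eq (a := Θ.grKey c) (b := lexKey I)).1 hc
  induction n generalizing I with
  | zero =>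
    refine key I (Set.finite_empty.subset fun c hc => ?_)
    exact absurd hc (not_lt.2 ((isGRTerm_zero_iff.1 hI).2 c))
  | succ n ih =>
    obtain ⟨J, hJ, -, -, hmin⟩ := isGRTerm_succ_iff.1 hI
    refine key I ((ih hJ).subset fun c hc => ?_)
    by_contra hcJ
    exact absurd hc (not_lt.2 (hmin c (not_le.1 hcJ)))

theorem exists_isGRTerm [Infinite (IndClass C)] (n : ℕ) : ∃ I, Θ.IsGRTerm n I := by
  induction n with
  | zero =>
    obtain ⟨c, -, hc⟩ := H.exists_least_grKey hfin htheta hone Set.finite_empty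
    exact ⟨_, isGRTerm_zero_iff.2 ⟨⟨c, rfl⟩, fun d => hc d (Set.notMem_empty d)⟩⟩
  | succ n ih =>
    obtain ⟨J, hJ⟩ := ih
    obtain ⟨c, hcJ, hc⟩ := H.exists_least_grKey hfin htheta hone
      (H.finite_le_of_isGRTerm hfin htheta hone hJ)
    exact ⟨_, isGRTerm_succ_iff.2 ⟨J, hJ, ⟨c, rfl⟩, not_le.1 hcJ, fun d hd => hc d (not_le.2 hd)⟩⟩

theorem finite_indClass_of_grChainBounded (h : Θ.GRChainBounded) : Finite (IndClass C) := by
  by_contra hinf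
  have := not_finite_iff_infinite.1 hinf
  obtain ⟨b, hb⟩ := h
  have := hb (H.exists_isGRTerm hfin htheta hone (b + 1))
  omega

end IsKrullSchmidtLength

end LengthFunction

end Chain

theorem theorem4p5
    -- an artin algebra `Λ` with centre `R = Subring.center Λ`
    {k Λ : Type*} [CommRing k] [IsArtinianRing k] [Ring Λ] [Algebra k Λ] [Module.Finite k Λ]
    -- a Krull-Schmidt extriangulated category, linear over the centre
    {C : Type u} [Category.{v} C] [Preadditive C] [HasFiniteBiproducts C] [HasBinaryBiproducts C]
    [Linear (Subring.center Λ) C] (hKS : IsKrullSchmidt C)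
    (𝓔 : ExtriangulatedData.{w} C) (h𝓔 : IsExtriangulated 𝓔)
    [𝓔.RLinear (Subring.center Λ)]
    -- a length function which makes it a length category of finite type
    (Θ : LengthFunction 𝓔) (hΘ : Θ.IsLengthCategory)
    (hfin : 𝓔.RFinite (Subring.center Λ))
    (htheta : Θ.thetaOne = Θ.thetaInfty)
    (hone : (isoClass '' Θ.thetaOne).Finite) :
    List.TFAE
      [Finite (IndClass C),
       BddAbove {n : ℕ | ∃ M : C, Indecomposable M ∧ Θ.len M = n},
       Θ.GRChainBounded] := by
  tfae_have 1 → 2 := fun _ => by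
    refine ((Set.finite_range fun c : IndClass C => Θ.isoLen c.1).subset ?_).bddAbove
    rintro _ ⟨M, hM, rfl⟩
    exact ⟨indClass hM, rfl⟩
  tfae_have 2 → 3 := LengthFunction.grChainBounded_of_bddAbove
  tfae_have 3 → 1 := LengthFunction.IsKrullSchmidtLength.finite_indClass_of_grChainBounded
    ⟨hKS, h𝓔, hΘ⟩ hfin htheta hone
  tfae_finish
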